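/- Let $q,m\ge 1$ and $n,d\ge 0$ be integers, and let $S_1,\dots,S_q\in\mathbb{R}^{m\times n}$ be independent Gaussian sketching matrices: all their entries are independent with law $\mathcal N(0,1/m)$, so that $\mathbb{E}[S_k^TS_k]=I_n$. For $A\in\mathbb{R}^{n\times d}$ of full column rank $d$ and $b\in\mathbb{R}^n$ let $f(x)=f_{A,b}(x)=\|Ax-b\|_2^2$ and $x^*=x^*_{A,b}=\arg\min_x f(x)$. An estimator is a measurable function $g:\mathbb{R}^{m\times d}\times\mathbb{R}^m\to\mathbb{R}^d$. Given estimators $g_1,\dots,g_q$, put $\hat x_k=g_k(S_kA,S_kb)$ and $\bar x=\frac1q\sum_{k=1}^q\hat x_k$. All expectations are over the sketching matrices, and $\mathbb{E}[f(\bar x)]$ is allowed to be $+\infty$. (i) Suppose $m>d+1$, and suppose that every $\hat x_k$ is unbiased, that is, for all $A$ of full column rank and all $b$ the vector $\hat x_k$ is integrable and $\mathbb{E}[\hat x_k]=x^*_{A,b}$. Then for all $A$ of full column rank and all $b$ $$\mathbb{E}[f(\bar x)]-f(x^*)\ \ge\ \frac{f(x^*)}{q}\,\frac{d}{m-d-1}.$$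 The averaged sketched least squares estimator is optimal among these: if $m>d+1$ and $g_k(M,y)\in\arg\min_x\|Mx-y\|_2^2$ for all $M,y,k$ (that is, $\hat x_k\in\arg\min_x\|S_kAx-S_kb\|_2^2$), then every $\hat x_k$ is unbiased in the above sense, and equality holds for all $A$ of full column rank and all $b$. (ii) For arbitrary, possibly biased estimators the following lower bound holds in the worst case over the unknown solution. For all $A$ of full column rank, all $b$, and all estimators $g_1,\dots,g_q$ (which may be chosen depending on $A$ and $b$), $$\sup_{z\in\mathbb{R}^d}\Bigl(\mathbb{E}\bigl[f_{A,b+Az}(\bar x)\bigr]-f_{A,b+Az}(x^*_{A,b+Az})\Bigr)\ \ge\ \frac{f_{A,b}(x^*_{A,b})}{q}\,\frac{d}{m},$$ where $\bar x$ is computed from the sketches $(S_kA,S_k(b+Az))$. The targets $b+Az$ all have the same residual $b-Ax^*_{A,b}$, hence the same optimal value, and $x^*_{A,b+Az}=x^*_{A,b}+z$. -/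

import Mathlib

open MeasureTheory ProbabilityTheory Matrix
open scoped NNReal ENNReal

noncomputable section

/-- The least squares cost `f(x) = ‖A x - b‖₂²` (Euclidean norm). -/
def lsCost {n d : ℕ} (A : Matrix (Fin n) (Fin d) ℝ) (b : Fin n → ℝ) (x : Fin d → ℝ) : ℝ :=
  ‖WithLp.toLp 2 (A *ᵥ x - b)‖ ^ 2

/-- `x` is a minimizer of `‖A x - b‖₂²`, i.e. a (the, if `A` has full column rank) solution
`x* = argmin f`. -/
def IsLeastSquaresSol {n d : ℕ} (A : Matrix (Fin n) (Fin d) ℝ) (b : Fin n → ℝ)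
    (x : Fin d → ℝ) : Prop :=
  ∀ z : Fin d → ℝ, lsCost A b x ≤ lsCost A b z

/-- `S 1, …, S q` are independent `m × n` Gaussian sketching matrices: all the entries of all
the matrices are independent with law `N(0, 1/m)` (variance `1/m`, so `E[Sᵀ S] = I`). -/
structure IsGaussianSketch {Ω : Type*} [MeasurableSpace Ω] (P : Measure Ω) {q m n : ℕ}
    (S : Fin q → Ω → Matrix (Fin m) (Fin n) ℝ) : Prop where
  law : ∀ (k : Fin q) (i : Fin m) (j : Fin n),
    HasLaw (fun ω => S k ω i j) (gaussianReal 0 ((m : ℝ≥0)⁻¹)) P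
  indep : iIndepFun (fun (p : Fin q × Fin m × Fin n) (ω : Ω) => S p.1 ω p.2.1 p.2.2) P

/-- An estimator for one worker: it maps the sketched data `(S A, S b)` to a vector in `ℝ^d`. -/
abbrev Estimator (m d : ℕ) : Type :=
  Matrix (Fin m) (Fin d) ℝ → (Fin m → ℝ) → (Fin d → ℝ)

/-- Joint measurability of an estimator in the sketched data (a matrix is read as the array of
its entries). -/
def Estimator.IsMeasurable {m d : ℕ} (g : Estimator m d) : Prop :=
  Measurable fun p : (Fin m → Fin d → ℝ) × (Fin m → ℝ) => g (Matrix.of p.1) p.2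

/-- The single-sketch estimate `x̂ = g(S A, S b)`. -/
def estimate {m n d : ℕ} (g : Estimator m d) (A : Matrix (Fin n) (Fin d) ℝ) (b : Fin n → ℝ)
    (T : Matrix (Fin m) (Fin n) ℝ) : Fin d → ℝ :=
  g (T * A) (T *ᵥ b)

/-- The averaged estimate `x̄ = (1/q) ∑ₖ x̂ₖ`, where `x̂ₖ = gₖ(Sₖ A, Sₖ b)`. -/
def averagedEstimate {q m n d : ℕ} (g : Fin q → Estimator m d)
    (A : Matrix (Fin n) (Fin d) ℝ) (b : Fin n → ℝ)
    (T : Fin q → Matrix (Fin m) (Fin n) ℝ) : Fin d → ℝ :=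
  (q : ℝ)⁻¹ • ∑ k, estimate (g k) A b (T k)

/-- The estimator `g`, applied to the sketch `T`, is unbiased: for every problem `(A, b)` with
`A` of full column rank, `x̂` has finite mean and `E[x̂] = x*`. -/
def IsUnbiased {Ω : Type*} [MeasurableSpace Ω] (P : Measure Ω) {m n d : ℕ}
    (T : Ω → Matrix (Fin m) (Fin n) ℝ) (g : Estimator m d) : Prop :=
  ∀ (A : Matrix (Fin n) (Fin d) ℝ) (b : Fin n → ℝ) (xs : Fin d → ℝ),
    A.rank = d → IsLeastSquaresSol A b xs →
      Integrable (fun ω => estimate g A b (T ω)) P ∧ ∫ ω, estimate g A b (T ω) ∂P = xs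

/-- The expected cost `E[f(x̄)] ∈ [0, ∞]` of the averaged estimator. -/
def expectedCost {Ω : Type*} [MeasurableSpace Ω] (P : Measure Ω) {q m n d : ℕ}
    (S : Fin q → Ω → Matrix (Fin m) (Fin n) ℝ) (g : Fin q → Estimator m d)
    (A : Matrix (Fin n) (Fin d) ℝ) (b : Fin n → ℝ) : ℝ≥0∞ :=
  ∫⁻ ω, ENNReal.ofReal (lsCost A b (averagedEstimate g A b fun k => S k ω)) ∂P

/-- The expected error `E[f(x̄)] - f(x*) ∈ [0, ∞]`. As `x*` minimizes `f`, the number subtracted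
is finite and at most `E[f(x̄)]`, so the subtraction is not truncated. -/
def expectedError {Ω : Type*} [MeasurableSpace Ω] (P : Measure Ω) {q m n d : ℕ}
    (S : Fin q → Ω → Matrix (Fin m) (Fin n) ℝ) (g : Fin q → Estimator m d)
    (A : Matrix (Fin n) (Fin d) ℝ) (b : Fin n → ℝ) (xs : Fin d → ℝ) : ℝ≥0∞ :=
  expectedCost P S g A b - ENNReal.ofReal (lsCost A b xs)

/-- The sketched least squares estimator `argmin_x ‖S A x - S b‖₂²`, solved by each worker in
distributed randomized regression. -/
def Estimator.IsSketchedLeastSquares {m d : ℕ} (g : Estimator m d) : Prop :=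
  ∀ (M : Matrix (Fin m) (Fin d) ℝ) (y : Fin m → ℝ), IsLeastSquaresSol M y (g M y)

end

/-!
Write `σ² = f(x*)` and choose an invertible `R` with `Rᵀ R = Aᵀ A`. The law of a linear image of a
Gaussian vector depends only on a Gram matrix (`map_vecMul_gaussianVec_congr`), so the data
`(Sₖ A, Sₖ b)` have the law of `(Gₖ R, Gₖ R x* + σ ξₖ)`, where the entries of `Gₖ` and `ξₖ` are
independent and `N(0, 1/m)`, and the expected error of an estimate is that of `R (x̄ - x*)` in this
model (`IsGaussianSketch.expectedError_eq`). This reduces the theorem to canonical coordinates.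

*Sketched least squares.* Its error in canonical coordinates is `σ (GᵀG)⁻¹ Gᵀ ξ`, averaged over the
sketches. It is odd in `ξ`, hence has mean zero, and given `G` the `j`-th coordinate for one sketch
has variance `σ²/m ((GᵀG)⁻¹)ⱼⱼ`. The entry `((GᵀG)⁻¹)ⱼⱼ` is the inverse squared distance of a column
of `G` from the span of the others, an inverse chi-square variable with `m - d + 1` degrees of
freedom up to scale; its mean is computed in `lintegral_inv_mul_transpose_diag`.

*Unbiased estimators.* Let the rows of the data of sketch `k` have the covariance `NₖᵀNₖ / m`. When
the `Nₖ` range independently over all invertible matrices, the Gram matrices of the data of the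
sketches are a complete statistic (`integral_mul_blockGram_eq_zero`, from uniqueness of Laplace
transforms). The least squares errors are functions of them, and the difference of two unbiased
estimators has mean zero under all these laws, so it is orthogonal to the least squares error and
can only increase the second moment. The `Nₖ` may differ from sketch to sketch because unbiasedness
is a condition on each estimator separately, for all problems `(A, b)`.

*Arbitrary estimators.* Put a Gaussian prior of scale `t` on `θ = R z`. Given `G`, a coordinate of
the error is a function of `y = σ ξ + G θ` minus `θⱼ`. The `j`-th score is a linear functional of
`(ξ, θ)` uncorrelated with `y`, so the reflection along it preserves the law of `(ξ, θ)` and the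
data `y`, and moves `θⱼ`: this bounds the mean squared error from below
(`le_lintegral_sq_sub_gaussianVec`), a form of the van Trees inequality that needs no regularity.
Averaging over `G` and letting `t → ∞` gives `σ² d / (q m)`
(`IsGaussianSketch.le_iSup_expectedError`).
-/

/-! ### Gaussian vectors with independent entries -/

/-- The law of a vector indexed by `α` with independent centred Gaussian entries of
variance `v`. -/
noncomputable abbrev gaussianVec (α : Type*) [Fintype α] (v : ℝ≥0) : Measure (α → ℝ) :=
  Measure.pi fun _ : α => gaussianReal 0 v

lemma charFunDual_gaussianVec {α : Type*} [Fintype α] (v : ℝ≥0) (c : α → ℝ) :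
    ∫ x, Complex.exp ((x ⬝ᵥ c : ℝ) * Complex.I) ∂(gaussianVec α v)
      = Complex.exp (-(v * (c ⬝ᵥ c) / 2 : ℝ)) := by
  have h : ∀ x : α → ℝ, Complex.exp ((x ⬝ᵥ c : ℝ) * Complex.I)
      = ∏ a, Complex.exp ((c a : ℂ) * (x a : ℝ) * Complex.I) := by
    intro x
    rw [← Complex.exp_sum]
    congr 1
    simp only [dotProduct, Complex.ofReal_sum, Finset.sum_mul, Complex.ofReal_mul]
    exact Finset.sum_congr rfl fun a _ => by ring
  simp_rw [h]
  rw [integral_fintype_prod_eq_prod (fun a (y : ℝ) =>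
    Complex.exp ((c a : ℂ) * (y : ℝ) * Complex.I))]
  simp_rw [← charFun_apply_real, charFun_gaussianReal]
  rw [← Complex.exp_sum]
  congr 1
  simp only [dotProduct, Complex.ofReal_div, Complex.ofReal_mul,
    Complex.ofReal_sum, Finset.mul_sum, Finset.sum_div, ← Finset.sum_neg_distrib]
  refine Finset.sum_congr rfl fun a _ => ?_
  simp only [Complex.ofReal_zero, mul_zero, zero_mul, zero_sub, Complex.ofReal_ofNat]
  congr 1
  ring_nf

lemma measurable_vecMul_const {α γ : Type*} [Fintype α] (C : Matrix α γ ℝ) :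
    Measurable fun x : α → ℝ => x ᵥ* C := by
  unfold vecMul dotProduct
  fun_prop

/-- A linear image of a Gaussian vector with independent entries is determined in law by its
covariance, the Gram matrix of the linear map. -/
lemma map_vecMul_gaussianVec_congr {α β γ : Type*} [Fintype α] [Fintype β] [Fintype γ]
    (v : ℝ≥0) {C : Matrix α γ ℝ} {D : Matrix β γ ℝ} (h : Cᵀ * C = Dᵀ * D) :
    (gaussianVec α v).map (fun x => x ᵥ* C) = (gaussianVec β v).map (fun x => x ᵥ* D) := by
  classical
  have hC : Measurable fun x : α → ℝ => x ᵥ* C := measurable_vecMul_const C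
  have hD : Measurable fun x : β → ℝ => x ᵥ* D := measurable_vecMul_const D
  have := Measure.isProbabilityMeasure_map (μ := gaussianVec α v) hC.aemeasurable
  have := Measure.isProbabilityMeasure_map (μ := gaussianVec β v) hD.aemeasurable
  refine Measure.ext_of_charFunDual (funext fun L => ?_)
  have key : ∀ x : γ → ℝ, L x = x ⬝ᵥ fun c => L (Pi.single c 1) := by
    intro x
    conv_lhs => rw [← L.sum_comp_single]
    simp only [dotProduct]
    refine Finset.sum_congr rfl fun c _ => ?_
    have : (Pi.single c (x c) : γ → ℝ) = x c • Pi.single c 1 := by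
      rw [← Pi.single_smul]; simp
    simp [this]
  set l : γ → ℝ := fun c => L (Pi.single c 1)
  rw [charFunDual_apply, charFunDual_apply, integral_map hC.aemeasurable (by fun_prop),
    integral_map hD.aemeasurable (by fun_prop)]
  simp_rw [key, ← dotProduct_mulVec]
  rw [charFunDual_gaussianVec, charFunDual_gaussianVec]
  have e1 : C *ᵥ l ⬝ᵥ C *ᵥ l = l ⬝ᵥ (Cᵀ * C) *ᵥ l := by
    rw [← mulVec_mulVec, dotProduct_mulVec l, vecMul_transpose]
  have e2 : D *ᵥ l ⬝ᵥ D *ᵥ l = l ⬝ᵥ (Dᵀ * D) *ᵥ l := by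
    rw [← mulVec_mulVec, dotProduct_mulVec l, vecMul_transpose]
  rw [e1, e2, h]

/-- An isometric linear image of a Gaussian vector with independent entries is again one. -/
lemma measurePreserving_vecMul_gaussianVec {α γ : Type*} [Fintype α] [Fintype γ] [DecidableEq γ]
    (v : ℝ≥0) {C : Matrix α γ ℝ} (h : Cᵀ * C = 1) :
    MeasurePreserving (fun x : α → ℝ => x ᵥ* C) (gaussianVec α v) (gaussianVec γ v) := by
  refine ⟨measurable_vecMul_const C, ?_⟩
  rw [map_vecMul_gaussianVec_congr v (D := (1 : Matrix γ γ ℝ)) (by simp [h])]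
  simp

/-- Restricting a Gaussian vector along an injection of index types. -/
lemma measurePreserving_comp_gaussianVec {α γ : Type*} [Fintype α] [Fintype γ]
    (v : ℝ≥0) {e : γ → α} (he : Function.Injective e) :
    MeasurePreserving (fun x : α → ℝ => fun c => x (e c)) (gaussianVec α v) (gaussianVec γ v) := by
  classical
  have := measurePreserving_vecMul_gaussianVec v
    (C := (Matrix.of fun a c => if a = e c then (1 : ℝ) else 0 : Matrix α γ ℝ)) (by
      ext c c'
      simp [Matrix.mul_apply, Matrix.one_apply, he.eq_iff, eq_comm])
  convert this using 3 with x c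
  simp [vecMul, dotProduct]

lemma gaussianVec_eq_withDensity {α : Type*} [Fintype α] {v : ℝ≥0} (hv : v ≠ 0) :
    gaussianVec α v = (volume : Measure (α → ℝ)).withDensity
      (fun x => ENNReal.ofReal (∏ a, gaussianPDFReal 0 v (x a))) := by
  refine Measure.pi_eq fun s hs => ?_
  rw [withDensity_apply _ (MeasurableSet.univ_pi hs), volume_pi, Measure.restrict_pi_pi]
  have hint : ∀ a : α, Integrable (gaussianPDFReal 0 v) (volume.restrict (s a)) := fun a =>
    (integrable_gaussianPDFReal 0 v).integrableOn
  rw [← ofReal_integral_eq_lintegral_ofReal (Integrable.fintype_prod hint)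
    (ae_of_all _ fun x => Finset.prod_nonneg fun a _ => gaussianPDFReal_nonneg _ _ _),
    integral_fintype_prod_eq_prod (fun _ => gaussianPDFReal 0 v),
    ENNReal.ofReal_prod_of_nonneg (fun a _ => integral_nonneg (gaussianPDFReal_nonneg _ _))]
  refine Finset.prod_congr rfl fun a _ => ?_
  rw [gaussianReal_apply 0 hv, ofReal_integral_eq_lintegral_ofReal (hint a)
    (ae_of_all _ fun x => gaussianPDFReal_nonneg _ _ _)]
  rfl

lemma prod_gaussianPDFReal {α : Type*} [Fintype α] (v : ℝ≥0) (x : α → ℝ) :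
    ∏ a, gaussianPDFReal 0 v (x a)
      = (√(2 * Real.pi * v))⁻¹ ^ Fintype.card α * Real.exp (-(x ⬝ᵥ x) / (2 * v)) := by
  simp only [gaussianPDFReal, Finset.prod_mul_distrib, Finset.prod_const, Finset.card_univ,
    ← Real.exp_sum, sub_zero]
  congr 2
  simp only [dotProduct, ← Finset.sum_neg_distrib, Finset.sum_div]
  exact Finset.sum_congr rfl fun a _ => by ring

/-- The image of a Gaussian vector under an invertible matrix `M` has density proportional to
`exp ((|z|² - |z M⁻¹|²) / (2 v))` with respect to the original law. -/
lemma exists_map_vecMul_gaussianVec_eq {α : Type*} [Fintype α] [DecidableEq α] {v : ℝ≥0}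
    (hv : v ≠ 0) {M N : Matrix α α ℝ} (hMN : M * N = 1) :
    ∃ c : ℝ≥0∞, c ≠ 0 ∧ c ≠ ⊤ ∧ (gaussianVec α v).map (fun x => x ᵥ* M)
      = c • (gaussianVec α v).withDensity
          (fun z => ENNReal.ofReal (Real.exp ((z ⬝ᵥ z - (z ᵥ* N) ⬝ᵥ (z ᵥ* N)) / (2 * v)))) := by
  have hdet : LinearMap.det (Matrix.toLin' Mᵀ) ≠ 0 := by
    rw [LinearMap.det_toLin', det_transpose]
    intro h0
    have := congrArg det hMN
    rw [det_mul, h0, zero_mul, det_one] at this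
    exact zero_ne_one this
  have hvol := Real.map_linearMap_volume_pi_eq_smul_volume_pi hdet
  have hfun : (fun x : α → ℝ => x ᵥ* M) = ⇑(Matrix.toLin' Mᵀ) := by
    ext x : 1
    rw [toLin'_apply, mulVec_transpose]
  refine ⟨ENNReal.ofReal |(LinearMap.det (Matrix.toLin' Mᵀ))⁻¹|, ?_, ENNReal.ofReal_ne_top, ?_⟩
  · rw [Ne, ENNReal.ofReal_eq_zero, not_le, abs_pos]
    exact inv_ne_zero hdet
  set k : ℝ≥0∞ := ENNReal.ofReal |(LinearMap.det (Matrix.toLin' Mᵀ))⁻¹|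
  have hmM := measurable_vecMul_const M
  have hmN := measurable_vecMul_const N
  have hdot : Measurable fun x : α → ℝ => x ⬝ᵥ x :=
    (Continuous.dotProduct continuous_id continuous_id).measurable
  have hd : Measurable fun z : α → ℝ =>
      ENNReal.ofReal (Real.exp ((z ⬝ᵥ z - (z ᵥ* N) ⬝ᵥ (z ᵥ* N)) / (2 * v))) :=
    (((hdot.sub (hdot.comp hmN)).div_const _).exp).ennreal_ofReal
  have hp : Measurable fun x : α → ℝ => ENNReal.ofReal (∏ a, gaussianPDFReal 0 v (x a)) := by
    refine Measurable.ennreal_ofReal ?_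
    exact Finset.measurable_prod _ fun a _ => (measurable_gaussianPDFReal 0 v).comp
      (measurable_pi_apply a)
  refine Measure.ext_of_lintegral _ fun f hf => ?_
  rw [lintegral_map hf hmM, lintegral_smul_measure,
    lintegral_withDensity_eq_lintegral_mul _ hd hf, gaussianVec_eq_withDensity hv,
    lintegral_withDensity_eq_lintegral_mul _ hp
      (show Measurable fun x => f (x ᵥ* M) from hf.comp hmM),
    lintegral_withDensity_eq_lintegral_mul _ hp (hd.mul hf)]
  have e1 : ∀ x : α → ℝ, (x ᵥ* M) ᵥ* N = x := fun x => by rw [vecMul_vecMul, hMN, vecMul_one]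
  have e2 := lintegral_map (μ := (volume : Measure (α → ℝ)))
    (f := fun z => ENNReal.ofReal (∏ a, gaussianPDFReal 0 v ((z ᵥ* N) a)) * f z)
    ((hp.comp hmN).mul hf) hmM
  rw [hfun, hvol, lintegral_smul_measure] at e2
  simp only [e1] at e2
  simp only [Pi.mul_apply]
  rw [← e2]
  congr 1
  refine lintegral_congr fun z => ?_
  rw [← mul_assoc, ← ENNReal.ofReal_mul
      (Finset.prod_nonneg fun a _ => gaussianPDFReal_nonneg _ _ _),
    prod_gaussianPDFReal, prod_gaussianPDFReal, mul_assoc _ (Real.exp _), ← Real.exp_add]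
  congr 4
  ring

/-- The second moment of a linear form in a Gaussian vector. -/
lemma lintegral_sq_dotProduct_gaussianVec {α : Type*} [Fintype α] (v : ℝ≥0) (c : α → ℝ) :
    ∫⁻ x, ENNReal.ofReal ((x ⬝ᵥ c) ^ 2) ∂(gaussianVec α v) = ENNReal.ofReal (v * (c ⬝ᵥ c)) := by
  have hc : 0 ≤ c ⬝ᵥ c := by
    simp only [dotProduct]; exact Finset.sum_nonneg fun i _ => mul_self_nonneg _
  have hlaw := map_vecMul_gaussianVec_congr v (C := (Matrix.of fun a (_ : Unit) => c a))
    (D := (Matrix.of fun (_ : Unit) (_ : Unit) => √(c ⬝ᵥ c))) (by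
      ext i j
      simp only [Matrix.mul_apply, transpose_apply, of_apply, Finset.univ_unique,
        Finset.sum_singleton, Real.mul_self_sqrt hc]
      rfl)
  have hf : Measurable fun y : Unit → ℝ => ENNReal.ofReal ((y ()) ^ 2) := by fun_prop
  have := congrArg (fun μ => ∫⁻ y, ENNReal.ofReal ((y ()) ^ 2) ∂μ) hlaw
  rw [lintegral_map hf (measurable_vecMul_const _), lintegral_map hf (measurable_vecMul_const _)]
    at this
  simp only [vecMul, of_apply] at this
  refine this.trans ?_
  have h1 : ∀ x : Unit → ℝ, (x ⬝ᵥ fun _ => √(c ⬝ᵥ c)) ^ 2 = (c ⬝ᵥ c) * (x ()) ^ 2 := by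
    intro x
    have : (x ⬝ᵥ fun _ => √(c ⬝ᵥ c)) = x () * √(c ⬝ᵥ c) := by simp [dotProduct]
    rw [this, mul_pow, Real.sq_sqrt hc, mul_comm]
  have hint : Integrable (fun y : ℝ => y ^ 2) (gaussianReal 0 v) :=
    (IsGaussian.memLp_two_id (μ := gaussianReal 0 v)).integrable_sq
  have h2 : ∫ y, y ^ 2 ∂(gaussianReal 0 v) = v := by
    have h := variance_of_integral_eq_zero (X := id) (μ := gaussianReal 0 v) aemeasurable_id
      (by simp)
    rw [variance_id_gaussianReal] at h
    simpa using h.symm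
  simp_rw [h1, ENNReal.ofReal_mul hc]
  rw [lintegral_const_mul _ hf]
  have := (measurePreserving_eval (fun _ : Unit => gaussianReal 0 v) ()).lintegral_comp
    (f := fun y => ENNReal.ofReal (y ^ 2)) (by fun_prop)
  simp only [Function.eval] at this
  rw [this, ← ofReal_integral_eq_lintegral_ofReal hint (ae_of_all _ fun y => sq_nonneg y), h2,
    ← ENNReal.ofReal_mul hc, mul_comm]

/-! ### Orthogonality from exponential tilts -/

lemma integral_withDensity_ofReal {X : Type*} [MeasurableSpace X] {μ : Measure X}
    {E : Type*} [NormedAddCommGroup E] [NormedSpace ℝ E]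
    {h : X → ℝ} (hh : Measurable h) (f : X → E) :
    ∫ x, f x ∂(μ.withDensity fun x => ENNReal.ofReal (h x)) = ∫ x, max (h x) 0 • f x ∂μ :=
  integral_withDensity_eq_integral_smul (f := fun x => (h x).toNNReal) hh.real_toNNReal f

lemma integrable_withDensity_ofReal {X : Type*} [MeasurableSpace X] {μ : Measure X}
    {E : Type*} [NormedAddCommGroup E] [NormedSpace ℝ E]
    {h : X → ℝ} (hh : Measurable h) {f : X → E} :
    Integrable f (μ.withDensity fun x => ENNReal.ofReal (h x))
      ↔ Integrable (fun x => max (h x) 0 • f x) μ :=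
  integrable_withDensity_iff_integrable_smul (f := fun x => (h x).toNNReal) hh.real_toNNReal

lemma integrable_max_zero_mul {X : Type*} [MeasurableSpace X] {μ : Measure X}
    {h f : X → ℝ} (hh : Measurable h) (hf : AEStronglyMeasurable f μ)
    (hi : Integrable (fun x => h x * f x) μ) :
    Integrable (fun x => max (h x) 0 * f x) μ := by
  refine hi.mono ((hh.max measurable_const).aestronglyMeasurable.mul hf) (ae_of_all _ fun x => ?_)
  rw [norm_mul, norm_mul]
  gcongr
  rw [Real.norm_eq_abs, Real.norm_eq_abs, abs_of_nonneg (le_max_right _ _)]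
  exact max_le (le_abs_self _) (abs_nonneg _)

lemma integral_max_zero_mul_sub {X : Type*} [MeasurableSpace X] {μ : Measure X}
    {h f : X → ℝ} (hh : Measurable h) (hf : AEStronglyMeasurable f μ)
    (hi : Integrable (fun x => h x * f x) μ) :
    ∫ x, max (h x) 0 * f x ∂μ - ∫ x, max (-h x) 0 * f x ∂μ = ∫ x, h x * f x ∂μ := by
  rw [← integral_sub (integrable_max_zero_mul hh hf hi)
    (integrable_max_zero_mul (h := fun x => -h x) hh.neg hf (by simpa using hi.neg))]
  refine integral_congr_ae (ae_of_all _ fun x => ?_)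
  simp only [← sub_mul]
  congr 1
  rcases le_total 0 (h x) with h0 | h0
  · rw [max_eq_left h0, max_eq_right (by linarith)]; ring
  · rw [max_eq_right h0, max_eq_left (by linarith)]; ring

/-- Two finite measures under which a real variable has the same moment generating function
near `0` give it the same characteristic function. -/
lemma complexMGF_I_eq_of_mgf_eq {Ω Ω' : Type*} [MeasurableSpace Ω] [MeasurableSpace Ω']
    {μ : Measure Ω} {ν : Measure Ω'} {X : Ω → ℝ} {Y : Ω' → ℝ} {ε : ℝ} (hε : 0 < ε)
    (hX : ∀ t, |t| < ε → Integrable (fun ω => Real.exp (t * X ω)) μ)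
    (hY : ∀ t, |t| < ε → Integrable (fun ω => Real.exp (t * Y ω)) ν)
    (h : ∀ t, |t| < ε → mgf X μ t = mgf Y ν t) :
    complexMGF X μ Complex.I = complexMGF Y ν Complex.I := by
  set U : Set ℂ := {z | z.re ∈ Set.Ioo (-ε) ε}
  have hsub : Set.Ioo (-ε) ε ⊆ interior (integrableExpSet X μ) :=
    interior_maximal (fun t ht => hX t (abs_lt.2 ht)) isOpen_Ioo
  have hsub' : Set.Ioo (-ε) ε ⊆ interior (integrableExpSet Y ν) :=
    interior_maximal (fun t ht => hY t (abs_lt.2 ht)) isOpen_Ioo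
  have aX : AnalyticOnNhd ℂ (complexMGF X μ) U :=
    analyticOnNhd_complexMGF.mono fun z hz => hsub hz
  have aY : AnalyticOnNhd ℂ (complexMGF Y ν) U :=
    analyticOnNhd_complexMGF.mono fun z hz => hsub' hz
  have hU : IsPreconnected U :=
    ((convex_Ioo (-ε) ε).linear_preimage Complex.reLm).isPreconnected
  refine aX.eqOn_of_preconnected_of_frequently_eq aY hU (z₀ := (0 : ℂ)) (by simp [U, hε]) ?_
    (show Complex.I ∈ U by simp [U, hε])
  have h_real : ∃ᶠ x : ℝ in nhdsWithin 0 {0}ᶜ, complexMGF X μ x = complexMGF Y ν x := by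
    refine Filter.Eventually.frequently ?_
    have : Set.Ioo (-ε) ε ∈ nhdsWithin (0 : ℝ) {0}ᶜ :=
      mem_nhdsWithin_of_mem_nhds (Ioo_mem_nhds (by linarith) hε)
    filter_upwards [this] with x hx
    rw [complexMGF_ofReal, complexMGF_ofReal, h x (abs_lt.2 hx)]
  have htend : Filter.Tendsto (fun x : ℝ => (x : ℂ)) (nhdsWithin 0 {0}ᶜ) (nhdsWithin 0 {0}ᶜ) := by
    refine tendsto_nhdsWithin_iff.2 ⟨?_, ?_⟩
    · exact (Complex.continuous_ofReal.tendsto' 0 0 (by simp)).mono_left nhdsWithin_le_nhds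
    · filter_upwards [self_mem_nhdsWithin] with x hx
      simpa using hx
  exact htend.frequently h_real

/-- A function whose exponential tilts by all linear functionals of a statistic `W` integrate to
zero near the origin is orthogonal to every function of `W`: uniqueness of the Laplace
transform, applied to the positive and negative parts of `h`. -/
theorem integral_mul_comp_eq_zero_of_tilts {X V : Type*} [MeasurableSpace X] {μ : Measure X}
    [NormedAddCommGroup V] [NormedSpace ℝ V] [CompleteSpace V] [SecondCountableTopology V]
    [MeasurableSpace V] [BorelSpace V] {W : X → V} (hW : Measurable W) {h : X → ℝ}
    (hh : Measurable h)
    (H : ∀ φ : StrongDual ℝ V, ∃ ε > 0, ∀ t : ℝ, |t| < ε →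
      Integrable (fun x => h x * Real.exp (t * φ (W x))) μ ∧
        ∫ x, h x * Real.exp (t * φ (W x)) ∂μ = 0)
    {ψ : V → ℝ} (hψ : Measurable ψ) : ∫ x, h x * ψ (W x) ∂μ = 0 := by
  by_cases hi : Integrable (fun x => h x * ψ (W x)) μ
  swap
  · -- the Bochner integral of a nonintegrable function is `0`
    exact integral_undef hi
  have hneg : Measurable fun x => -h x := hh.neg
  have hh0 : Integrable h μ := by
    obtain ⟨ε, hε, h1⟩ := H 0
    simpa using (h1 0 (by simpa using hε)).1
  set μp := μ.withDensity fun x => ENNReal.ofReal (h x)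
  set μn := μ.withDensity fun x => ENNReal.ofReal (-h x)
  have : IsFiniteMeasure μp := isFiniteMeasure_withDensity_ofReal hh0.2
  have : IsFiniteMeasure μn := isFiniteMeasure_withDensity_ofReal hh0.neg.2
  have hmap : μp.map W = μn.map W := by
    refine Measure.ext_of_charFunDual (funext fun φ => ?_)
    obtain ⟨ε, hε, h1⟩ := H φ
    have hm : Measurable fun x => φ (W x) := φ.continuous.measurable.comp hW
    have hexp : ∀ t : ℝ, AEStronglyMeasurable (fun x => Real.exp (t * φ (W x))) μ := fun t =>
      (hm.const_mul t).exp.aestronglyMeasurable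
    have key := complexMGF_I_eq_of_mgf_eq (μ := μp) (ν := μn) (X := fun x => φ (W x))
      (Y := fun x => φ (W x)) hε ?_ ?_ ?_
    · rw [charFunDual_apply, charFunDual_apply, integral_map hW.aemeasurable (by fun_prop),
        integral_map hW.aemeasurable (by fun_prop)]
      simpa only [complexMGF, mul_comm Complex.I] using key
    · intro t ht
      rw [integrable_withDensity_ofReal hh]
      exact integrable_max_zero_mul hh (hexp t) (h1 t ht).1
    · intro t ht
      rw [integrable_withDensity_ofReal hneg]
      exact integrable_max_zero_mul hneg (hexp t) (by simpa using (h1 t ht).1.neg)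
    · intro t ht
      rw [mgf, mgf, integral_withDensity_ofReal hh, integral_withDensity_ofReal hneg]
      have := integral_max_zero_mul_sub hh (hexp t) (h1 t ht).1
      rw [(h1 t ht).2, sub_eq_zero] at this
      exact this
  have hψW : AEStronglyMeasurable (fun x => ψ (W x)) μ := (hψ.comp hW).aestronglyMeasurable
  rw [← integral_max_zero_mul_sub hh hψW hi, sub_eq_zero]
  have := congrArg (fun ν => ∫ w, ψ w ∂ν) hmap
  rw [integral_map hW.aemeasurable hψ.aestronglyMeasurable,
    integral_map hW.aemeasurable hψ.aestronglyMeasurable,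
    integral_withDensity_ofReal hh, integral_withDensity_ofReal hneg] at this
  exact this

/-! ### Completeness of block Gram matrices -/

lemma vecMul_blockDiagonal_apply {κ κ' ι : Type*} [Fintype κ] [Fintype ι] [DecidableEq ι]
    (R : ι → Matrix κ κ' ℝ) (s : κ × ι → ℝ) (c : κ') (i : ι) :
    (s ᵥ* blockDiagonal R) (c, i) = ((fun a => s (a, i)) ᵥ* R i) c := by
  simp only [vecMul, dotProduct, Fintype.sum_prod_type, blockDiagonal_apply, mul_ite, mul_zero]
  exact Finset.sum_congr rfl fun a _ => by simp

lemma abs_dotProduct_mulVec_le {κ : Type*} [Fintype κ] (L : Matrix κ κ ℝ) (z : κ → ℝ) :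
    |z ⬝ᵥ L *ᵥ z| ≤ (∑ a, ∑ b, |L a b|) * (z ⬝ᵥ z) := by
  have hz : ∀ a, z a ^ 2 ≤ z ⬝ᵥ z := fun a => by
    rw [sq]
    exact Finset.single_le_sum (f := fun a => z a * z a) (fun i _ => mul_self_nonneg _)
      (Finset.mem_univ a)
  generalize z ⬝ᵥ z = S at hz ⊢
  simp only [dotProduct, mulVec, Finset.mul_sum, Finset.sum_mul]
  refine (Finset.abs_sum_le_sum_abs _ _).trans (Finset.sum_le_sum fun a _ => ?_)
  refine (Finset.abs_sum_le_sum_abs _ _).trans (Finset.sum_le_sum fun b _ => ?_)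
  rw [show z a * (L a b * z b) = L a b * (z a * z b) by ring, abs_mul]
  refine mul_le_mul_of_nonneg_left (abs_le.2 ⟨?_, ?_⟩) (abs_nonneg _)
  · nlinarith [hz a, hz b, sq_nonneg (z a + z b)]
  · nlinarith [hz a, hz b, sq_nonneg (z a - z b)]

open scoped MatrixOrder in
lemma exists_transpose_mul_self_of_posDef {κ : Type*} [Fintype κ] [DecidableEq κ]
    {K : Matrix κ κ ℝ} (hK : K.PosDef) : ∃ B : Matrix κ κ ℝ, IsUnit B ∧ Bᵀ * B = K := by
  obtain ⟨B, hB⟩ := CStarAlgebra.nonneg_iff_eq_star_mul_self.1 hK.posSemidef.nonneg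
  rw [star_eq_conjTranspose, conjTranspose_eq_transpose_of_trivial] at hB
  refine ⟨B, ?_, hB.symm⟩
  have := hK.isUnit
  rw [hB, isUnit_iff_isUnit_det, det_mul] at this
  rw [isUnit_iff_isUnit_det]
  exact isUnit_of_mul_isUnit_right this

/-- A symmetric perturbation of the identity factors as `N Nᵀ` with `N` invertible. -/
lemma eventually_exists_mul_transpose_eq {κ : Type*} [Fintype κ] [DecidableEq κ]
    {L : Matrix κ κ ℝ} (hL : L.IsSymm) :
    ∀ᶠ t in nhds (0 : ℝ), ∃ N : Matrix κ κ ℝ, IsUnit N ∧ N * Nᵀ = 1 - t • L := by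
  set C : ℝ := ∑ a, ∑ b, |L a b|
  have hC : 0 ≤ C := Finset.sum_nonneg fun a _ => Finset.sum_nonneg fun b _ => abs_nonneg _
  have h1 : ∀ᶠ t in nhds (0 : ℝ), |t| * C < 1 := by
    have : Filter.Tendsto (fun t : ℝ => |t| * C) (nhds 0) (nhds 0) := by
      have hc : Continuous fun t : ℝ => |t| * C := by fun_prop
      simpa using hc.tendsto 0
    exact this.eventually (gt_mem_nhds one_pos)
  filter_upwards [h1] with t ht
  have hpd : (1 - t • L).PosDef := by
    rw [posDef_iff_dotProduct_mulVec]
    refine ⟨?_, fun x hx => ?_⟩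
    · rw [IsHermitian, conjTranspose_eq_transpose_of_trivial, transpose_sub, transpose_one,
        transpose_smul, hL.eq]
    · have hxx : 0 < x ⬝ᵥ x := by
        have := dotProduct_star_self_pos_iff.2 hx
        simpa using this
      have h2 := abs_dotProduct_mulVec_le L x
      have h3 : |t * (x ⬝ᵥ L *ᵥ x)| ≤ (|t| * C) * (x ⬝ᵥ x) := by
        rw [abs_mul, mul_assoc]
        exact mul_le_mul_of_nonneg_left h2 (abs_nonneg _)
      simp only [star_trivial, sub_mulVec, one_mulVec, smul_mulVec, dotProduct_sub,
        dotProduct_smul, smul_eq_mul]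
      nlinarith [(abs_le.1 h3).2]
  obtain ⟨B, hBu, hB⟩ := exists_transpose_mul_self_of_posDef hpd
  refine ⟨Bᵀ, ?_, by rw [transpose_transpose, hB]⟩
  rwa [isUnit_iff_isUnit_det, det_transpose, ← isUnit_iff_isUnit_det]

lemma strongDual_pi_pi_pi_apply {β κ : Type*} [Fintype β] [Fintype κ] [DecidableEq β]
    [DecidableEq κ] (φ : StrongDual ℝ (β → κ → κ → ℝ)) (w : β → κ → κ → ℝ) :
    φ w = ∑ k, ∑ a, ∑ b, w k a b * φ (Pi.single k (Pi.single a (Pi.single b 1))) := by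
  have : w = ∑ k, ∑ a, ∑ b, w k a b •
      (Pi.single k (Pi.single a (Pi.single b 1)) : β → κ → κ → ℝ) := by
    ext k a b
    simp only [Finset.sum_apply, Pi.smul_apply, smul_eq_mul]
    rw [Finset.sum_eq_single k, Finset.sum_eq_single a, Finset.sum_eq_single b]
    · simp
    all_goals simp +contextual [Pi.single_apply, ite_apply]
  conv_lhs => rw [this]
  simp only [map_sum, map_smul, smul_eq_mul]

/-- The Gram matrices `∑ sᵢ sᵢᵀ` of the blocks of rows of a data array; `p i` is the block to
which row `i` belongs. -/
def blockGram {κ ι β : Type*} [Fintype ι] [DecidableEq β] (p : ι → β) (s : κ × ι → ℝ) :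
    β → κ → κ → ℝ :=
  fun k a b => ∑ i, if p i = k then s (a, i) * s (b, i) else 0

/-- The block Gram matrices form a complete statistic for Gaussian data whose rows have, in each
block, an arbitrary nondegenerate covariance: a function `h` with mean zero under all these laws
is orthogonal to all functions of the Gram matrices. -/
theorem integral_mul_blockGram_eq_zero {κ ι β : Type*} [Fintype κ] [Fintype ι] [Fintype β]
    [DecidableEq κ] [DecidableEq ι] [DecidableEq β] (p : ι → β) {v : ℝ≥0} (hv : v ≠ 0)
    {h : (κ × ι → ℝ) → ℝ} (hh : Measurable h)
    (H : ∀ R : β → Matrix κ κ ℝ, (∀ k, IsUnit (R k)) →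
      Integrable (fun s => h (s ᵥ* blockDiagonal fun i => R (p i))) (gaussianVec (κ × ι) v) ∧
        ∫ s, h (s ᵥ* blockDiagonal fun i => R (p i)) ∂(gaussianVec (κ × ι) v) = 0)
    {ψ : (β → κ → κ → ℝ) → ℝ} (hψ : Measurable ψ) :
    ∫ s, h s * ψ (blockGram p s) ∂(gaussianVec (κ × ι) v) = 0 := by
  have hW : Measurable (blockGram p : (κ × ι → ℝ) → β → κ → κ → ℝ) := by
    refine measurable_pi_iff.2 fun k => measurable_pi_iff.2 fun a => measurable_pi_iff.2 fun b => ?_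
    unfold blockGram
    refine Finset.measurable_sum _ fun i _ => ?_
    split_ifs <;> fun_prop
  refine integral_mul_comp_eq_zero_of_tilts hW hh (fun φ => ?_) hψ
  set l : β → Matrix κ κ ℝ :=
    fun k => Matrix.of fun a b => φ (Pi.single k (Pi.single a (Pi.single b 1)))
  have hv' : (0 : ℝ) < v := NNReal.coe_pos.2 (pos_iff_ne_zero.2 hv)
  have hφ : ∀ s : κ × ι → ℝ, φ (blockGram p s)
      = ∑ i, (fun a => s (a, i)) ⬝ᵥ l (p i) *ᵥ fun a => s (a, i) := by
    intro s
    rw [strongDual_pi_pi_pi_apply]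
    simp only [blockGram, Finset.sum_mul, ite_mul, zero_mul, dotProduct, mulVec, Finset.mul_sum]
    rw [Finset.sum_comm]
    have : ∀ a, (∑ k, ∑ b, ∑ i, if p i = k then
        s (a, i) * s (b, i) * φ (Pi.single k (Pi.single a (Pi.single b 1))) else 0)
        = ∑ i, ∑ b, s (a, i) * (l (p i) a b * s (b, i)) := by
      intro a
      calc _ = ∑ k, ∑ i, ∑ b, (if p i = k then
        s (a, i) * s (b, i) * φ (Pi.single k (Pi.single a (Pi.single b 1))) else 0) :=
            Finset.sum_congr rfl fun k _ => Finset.sum_comm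
        _ = ∑ i, ∑ k, ∑ b, (if p i = k then
        s (a, i) * s (b, i) * φ (Pi.single k (Pi.single a (Pi.single b 1))) else 0) :=
            Finset.sum_comm
        _ = _ := by
            refine Finset.sum_congr rfl fun i _ => ?_
            rw [Finset.sum_comm]
            refine Finset.sum_congr rfl fun b _ => ?_
            simp only [Finset.sum_ite_eq, Finset.mem_univ, if_true, l, of_apply]
            ring
    simp_rw [this]
    exact Finset.sum_comm
  -- only the symmetric part of the functional matters on Gram matrices
  have hsymm : ∀ k, (l k + (l k)ᵀ).IsSymm := fun k => by
    rw [IsSymm, transpose_add, transpose_transpose, add_comm]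
  have hev : ∀ᶠ t in nhds (0 : ℝ), ∀ k, ∃ N : Matrix κ κ ℝ, IsUnit N ∧
      N * Nᵀ = 1 - t • (l k + (l k)ᵀ) :=
    Filter.eventually_all.2 fun k => eventually_exists_mul_transpose_eq (hsymm k)
  obtain ⟨ε, hε, hεN⟩ := Metric.eventually_nhds_iff.1 hev
  refine ⟨ε / v, by positivity, fun t ht => ?_⟩
  have htv : dist (v * t) 0 < ε := by
    rw [Real.dist_eq, sub_zero, abs_mul, abs_of_pos hv', mul_comm]
    rwa [lt_div_iff₀ hv'] at ht
  choose N hNu hN using hεN htv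
  obtain ⟨c, hc0, hct, hc⟩ := exists_map_vecMul_gaussianVec_eq (v := v) hv
    (M := blockDiagonal fun i => (N (p i))⁻¹) (N := blockDiagonal fun i => N (p i)) (by
      rw [← blockDiagonal_mul]
      have : (fun i => (N (p i))⁻¹ * N (p i)) = 1 := by
        funext i
        exact nonsing_inv_mul _ ((isUnit_iff_isUnit_det _).1 (hNu _))
      rw [this, blockDiagonal_one])
  have hexp : ∀ z : κ × ι → ℝ, (z ⬝ᵥ z - (z ᵥ* blockDiagonal fun i => N (p i)) ⬝ᵥ
      (z ᵥ* blockDiagonal fun i => N (p i))) / (2 * v) = t * φ (blockGram p z) := by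
    intro z
    have hrow : ∀ i, (∑ a, (z ᵥ* blockDiagonal fun i => N (p i)) (a, i) *
        (z ᵥ* blockDiagonal fun i => N (p i)) (a, i))
        = ∑ a, z (a, i) * z (a, i)
          - 2 * (v * t) * ((fun a => z (a, i)) ⬝ᵥ l (p i) *ᵥ fun a => z (a, i)) := by
      intro i
      simp only [vecMul_blockDiagonal_apply]
      set y : κ → ℝ := fun a => z (a, i)
      change (y ᵥ* N (p i)) ⬝ᵥ (y ᵥ* N (p i)) = y ⬝ᵥ y - _
      have e1 : (y ᵥ* N (p i)) ⬝ᵥ (y ᵥ* N (p i)) = y ⬝ᵥ (N (p i) * (N (p i))ᵀ) *ᵥ y := by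
        rw [← mulVec_mulVec, dotProduct_mulVec y, mulVec_transpose]
      have e2 : y ⬝ᵥ (l (p i))ᵀ *ᵥ y = y ⬝ᵥ l (p i) *ᵥ y := by
        rw [mulVec_transpose, dotProduct_comm, dotProduct_mulVec]
      rw [e1, hN, sub_mulVec, one_mulVec, smul_mulVec, add_mulVec, dotProduct_sub,
        dotProduct_smul, dotProduct_add, e2, smul_eq_mul]
      ring
    rw [hφ, dotProduct, dotProduct, Fintype.sum_prod_type_right, Fintype.sum_prod_type_right,
      Finset.sum_congr rfl fun i _ => hrow i, Finset.sum_sub_distrib, ← Finset.mul_sum]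
    field_simp
    ring
  simp_rw [hexp] at hc
  have hm : Measurable fun z => Real.exp (t * φ (blockGram p z)) :=
    ((φ.continuous.measurable.comp hW).const_mul t).exp
  obtain ⟨hi, h0⟩ := H (fun k => (N k)⁻¹) fun k => (isUnit_nonsing_inv_iff).2 (hNu k)
  have hmM := measurable_vecMul_const (blockDiagonal fun i => (N (p i))⁻¹)
  rw [← integral_map (f := h) hmM.aemeasurable hh.aestronglyMeasurable, hc,
    integral_smul_measure, integral_withDensity_ofReal hm] at h0
  have hi' : Integrable h ((gaussianVec (κ × ι) v).map
      (fun s => s ᵥ* blockDiagonal fun i => (N (p i))⁻¹)) :=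
    (integrable_map_measure hh.aestronglyMeasurable hmM.aemeasurable).2 hi
  rw [hc, integrable_smul_measure hc0 hct, integrable_withDensity_ofReal hm] at hi'
  have hmax : ∀ x : κ × ι → ℝ, max (Real.exp (t * φ (blockGram p x))) 0 • h x
      = h x * Real.exp (t * φ (blockGram p x)) := fun x => by
    rw [max_eq_left (Real.exp_pos _).le, smul_eq_mul, mul_comm]
  simp only [hmax] at h0 hi'
  refine ⟨hi', (smul_eq_zero.1 h0).resolve_left ?_⟩
  exact (ENNReal.toReal_pos hc0 hct).ne'

/-! ### Linear independence and inverse chi-square moments -/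

lemma det_mul_transpose_ne_zero_iff {κ ι : Type*} [Fintype κ] [DecidableEq κ] [Fintype ι]
    (H : Matrix κ ι ℝ) : (H * Hᵀ).det ≠ 0 ↔ LinearIndependent ℝ H.row := by
  rw [← vecMul_injective_iff]
  constructor
  · intro h
    have hu : IsUnit (H * Hᵀ) := (isUnit_iff_isUnit_det _).2 (isUnit_iff_ne_zero.2 h)
    have hinj := vecMul_injective_iff_isUnit.2 hu
    refine Function.Injective.of_comp (f := fun x => x ᵥ* Hᵀ) ?_
    convert! hinj using 1
    ext x : 1
    simp [Function.comp, vecMul_vecMul]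
  · intro h
    have := (PosDef.mul_conjTranspose_self H h).isUnit
    rw [conjTranspose_eq_transpose_of_trivial] at this
    exact isUnit_iff_ne_zero.1 ((isUnit_iff_isUnit_det _).1 this)

lemma measurableSet_linearIndependent (d m : ℕ) :
    MeasurableSet {H : Fin d → Fin m → ℝ | LinearIndependent ℝ H} := by
  have : {H : Fin d → Fin m → ℝ | LinearIndependent ℝ H}
      = (fun H : Fin d → Fin m → ℝ => (Matrix.of H * (Matrix.of H)ᵀ).det) ⁻¹' {0}ᶜ := by
    ext H
    exact (det_mul_transpose_ne_zero_iff (Matrix.of H)).symm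
  rw [this]
  refine (measurableSet_singleton 0).compl.preimage (Continuous.measurable ?_)
  have hc : Continuous fun H : Fin d → Fin m → ℝ => Matrix.of H := continuous_id
  exact (hc.matrix_mul hc.matrix_transpose).matrix_det

lemma gaussianVec_absolutelyContinuous {α : Type*} [Fintype α] {v : ℝ≥0} (hv : v ≠ 0) :
    gaussianVec α v ≪ volume := by
  rw [gaussianVec_eq_withDensity hv]
  exact withDensity_absolutelyContinuous _ _

/-- At most `m` Gaussian vectors in `ℝᵐ` are almost surely linearly independent. -/
lemma ae_linearIndependent_gaussianVec {m : ℕ} {v : ℝ≥0} (hv : v ≠ 0) :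
    ∀ d : ℕ, d ≤ m → ∀ᵐ H ∂(Measure.pi fun _ : Fin d => gaussianVec (Fin m) v),
      LinearIndependent ℝ H
  | 0, _ => ae_of_all _ fun H => linearIndependent_empty_type
  | d + 1, hd => by
    have ih := ae_linearIndependent_gaussianVec hv d (Nat.le_of_succ_le hd)
    have hmp := (measurePreserving_piFinSuccAbove
      (fun _ : Fin (d + 1) => gaussianVec (Fin m) v) 0).symm
    have key : ∀ᵐ z ∂((gaussianVec (Fin m) v).prod
        (Measure.pi fun _ : Fin d => gaussianVec (Fin m) v)),
        LinearIndependent ℝ ((MeasurableEquiv.piFinSuccAbove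
          (fun _ : Fin (d + 1) => Fin m → ℝ) 0).symm z) := by
      rw [← Measure.prod_swap, ae_map_iff measurable_swap.aemeasurable]
      swap
      · exact (measurableSet_linearIndependent (d + 1) m).preimage hmp.measurable
      rw [Measure.ae_prod_iff_ae_ae]
      swap
      · exact ((measurableSet_linearIndependent (d + 1) m).preimage hmp.measurable).preimage
          measurable_swap
      filter_upwards [ih] with f hf
      have hspan : Submodule.span ℝ (Set.range f) ≠ ⊤ := by
        intro htop
        have h1 := finrank_span_eq_card hf
        rw [htop, finrank_top] at h1
        simp at h1
        omega
      have h0 : gaussianVec (Fin m) v (Submodule.span ℝ (Set.range f)) = 0 :=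
        gaussianVec_absolutelyContinuous hv (Measure.addHaar_submodule _ _ hspan)
      have h1 : ∀ᵐ x ∂(gaussianVec (Fin m) v), x ∉ Submodule.span ℝ (Set.range f) := by
        rw [ae_iff]
        simpa using h0
      filter_upwards [h1] with x hx
      have : (MeasurableEquiv.piFinSuccAbove (fun _ : Fin (d + 1) => Fin m → ℝ) 0).symm
          (Prod.swap (f, x)) = (Fin.cons x f : Fin (d + 1) → Fin m → ℝ) := by
        simp [MeasurableEquiv.piFinSuccAbove]
        rfl
      rw [this, linearIndependent_finCons]
      exact ⟨hf, hx⟩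
    have := hmp.symm.quasiMeasurePreserving.ae key
    filter_upwards [this] with H hH
    have hHH := (MeasurableEquiv.piFinSuccAbove
      (fun _ : Fin (d + 1) => Fin m → ℝ) 0).symm_apply_apply H
    rw [← hHH]
    exact hH

lemma integral_exp_neg_mul_sq_gaussianReal {v : ℝ≥0} (hv : v ≠ 0) {t : ℝ} (ht : 0 ≤ t) :
    ∫ x, Real.exp (-t * x ^ 2) ∂(gaussianReal 0 v) = (1 + 2 * v * t) ^ (-(1 / 2) : ℝ) := by
  have hv' : (0 : ℝ) < v := NNReal.coe_pos.2 (pos_iff_ne_zero.2 hv)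
  rw [integral_gaussianReal_eq_integral_smul hv]
  have h1 : ∀ x : ℝ, gaussianPDFReal 0 v x • Real.exp (-t * x ^ 2)
      = (√(2 * Real.pi * v))⁻¹ * Real.exp (-(1 / (2 * v) + t) * x ^ 2) := by
    intro x
    rw [gaussianPDFReal, smul_eq_mul, mul_assoc, ← Real.exp_add]
    congr 2
    field_simp
    ring
  simp_rw [h1]
  rw [integral_const_mul, integral_gaussian, Real.rpow_neg (by positivity), ← Real.sqrt_eq_rpow,
    ← Real.sqrt_inv, ← Real.sqrt_inv, ← Real.sqrt_mul (by positivity)]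
  congr 1
  field_simp

lemma lintegral_exp_neg_mul_dotProduct {k : ℕ} {v : ℝ≥0} (hv : v ≠ 0) {t : ℝ} (ht : 0 ≤ t) :
    ∫⁻ x, ENNReal.ofReal (Real.exp (-t * (x ⬝ᵥ x))) ∂(gaussianVec (Fin k) v)
      = ENNReal.ofReal ((1 + 2 * v * t) ^ (-(k / 2) : ℝ)) := by
  have hv' : (0 : ℝ) < v := NNReal.coe_pos.2 (pos_iff_ne_zero.2 hv)
  have h1 : ∀ x : Fin k → ℝ, Real.exp (-t * (x ⬝ᵥ x)) = ∏ i, Real.exp (-t * x i ^ 2) := by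
    intro x
    rw [← Real.exp_sum, ← Finset.mul_sum]
    simp [dotProduct, sq]
  have hint : ∀ i : Fin k, Integrable (fun y : ℝ => Real.exp (-t * y ^ 2)) (gaussianReal 0 v) := by
    intro i
    refine (integrable_const (1 : ℝ)).mono' (by fun_prop) (ae_of_all _ fun y => ?_)
    rw [Real.norm_eq_abs, abs_of_pos (Real.exp_pos _), Real.exp_le_one_iff]
    nlinarith [mul_nonneg ht (sq_nonneg y)]
  simp_rw [h1]
  rw [← ofReal_integral_eq_lintegral_ofReal (Integrable.fintype_prod hint)
    (ae_of_all _ fun x => Finset.prod_nonneg fun i _ => (Real.exp_pos _).le),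
    integral_fintype_prod_eq_prod (fun _ (y : ℝ) => Real.exp (-t * y ^ 2)),
    Finset.prod_const, integral_exp_neg_mul_sq_gaussianReal hv ht, ← Real.rpow_natCast,
    ← Real.rpow_mul (by positivity)]
  congr 2
  simp
  ring

lemma ae_dotProduct_self_pos {k : ℕ} (hk : k ≠ 0) {v : ℝ≥0} (hv : v ≠ 0) :
    ∀ᵐ x ∂(gaussianVec (Fin k) v), 0 < x ⬝ᵥ x := by
  have : Nonempty (Fin k) := ⟨⟨0, Nat.pos_of_ne_zero hk⟩⟩
  have h : ∀ᵐ x ∂(gaussianVec (Fin k) v), x ≠ 0 := by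
    refine (gaussianVec_absolutelyContinuous hv).ae_le ?_
    change ∀ᵐ x ∂(volume : Measure (Fin k → ℝ)), x ≠ 0
    rw [ae_iff]
    simp
  filter_upwards [h] with x hx
  simpa using dotProduct_star_self_pos_iff.2 hx

/-- The mean of the inverse of a chi-square variable with `k ≥ 3` degrees of freedom, scaled by
`v`, from `1 / s = ∫₀^∞ exp (-t s) dt`. -/
lemma lintegral_inv_dotProduct_self {k : ℕ} (hk : 2 < k) {v : ℝ≥0} (hv : v ≠ 0) :
    ∫⁻ x, ENNReal.ofReal ((x ⬝ᵥ x)⁻¹) ∂(gaussianVec (Fin k) v)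
      = ENNReal.ofReal (1 / (v * ((k : ℝ) - 2))) := by
  have hv' : (0 : ℝ) < v := NNReal.coe_pos.2 (pos_iff_ne_zero.2 hv)
  have hk' : (0 : ℝ) < (k : ℝ) - 2 := by
    have : (2 : ℝ) < k := by exact_mod_cast hk
    linarith
  have h1 : ∀ s : ℝ, 0 < s → ENNReal.ofReal s⁻¹
      = ∫⁻ t in Set.Ioi (0 : ℝ), ENNReal.ofReal (Real.exp (-t * s)) := by
    intro s hs
    have hi := integrableOn_exp_mul_Ioi (a := -s) (by linarith) 0
    have he := integral_exp_mul_Ioi (a := -s) (by linarith) 0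
    have hswap : ∀ t : ℝ, -t * s = -s * t := fun t => by ring
    simp_rw [hswap]
    rw [← ofReal_integral_eq_lintegral_ofReal hi (ae_of_all _ fun t => (Real.exp_pos _).le), he]
    simp [neg_div_neg_eq]
  have hm : Measurable fun p : (Fin k → ℝ) × ℝ =>
      ENNReal.ofReal (Real.exp (-p.2 * (p.1 ⬝ᵥ p.1))) := by
    unfold dotProduct
    fun_prop
  rw [lintegral_congr_ae ((ae_dotProduct_self_pos (by omega) hv).mono fun x hx => h1 _ hx),
    lintegral_lintegral_swap hm.aemeasurable,
    setLIntegral_congr_fun measurableSet_Ioi fun t ht =>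
      lintegral_exp_neg_mul_dotProduct hv (le_of_lt ht)]
  set g : ℝ → ℝ := fun t => -((1 + 2 * v * t) ^ (1 - k / 2 : ℝ) / (v * ((k : ℝ) - 2)))
  have hder : ∀ t ∈ Set.Ici (0 : ℝ), HasDerivAt g ((1 + 2 * v * t) ^ (-(k / 2) : ℝ)) t := by
    intro t ht
    have ht' : (0 : ℝ) ≤ t := ht
    have hpos : 0 < 1 + 2 * v * t := by positivity
    have h2 : HasDerivAt (fun t : ℝ => 1 + 2 * v * t) (2 * v) t := by
      simpa using ((hasDerivAt_id t).const_mul (2 * (v : ℝ))).const_add 1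
    have h3 := ((h2.rpow_const (p := (1 - k / 2 : ℝ)) (Or.inl hpos.ne')).div_const
      (v * ((k : ℝ) - 2))).neg
    refine h3.congr_deriv ?_
    rw [show (1 - (k : ℝ) / 2 - 1) = -(k / 2) by ring]
    field_simp
    ring
  have hlim : Filter.Tendsto g Filter.atTop (nhds 0) := by
    have h2 : Filter.Tendsto (fun t : ℝ => 1 + 2 * v * t) Filter.atTop Filter.atTop :=
      Filter.tendsto_atTop_add_const_left _ _
        (Filter.tendsto_id.const_mul_atTop (by positivity))
    have h3 := (tendsto_rpow_neg_atTop (y := (k / 2 - 1 : ℝ)) (by linarith)).comp h2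
    have h4 := (h3.div_const (v * ((k : ℝ) - 2))).neg
    simp only [zero_div, neg_zero] at h4
    refine h4.congr fun t => ?_
    simp [g, neg_sub]
  have hnn : ∀ t ∈ Set.Ioi (0 : ℝ), 0 ≤ (1 + 2 * v * t) ^ (-(k / 2) : ℝ) := fun t ht => by
    have : (0 : ℝ) < t := ht
    positivity
  rw [← ofReal_integral_eq_lintegral_ofReal (integrableOn_Ioi_deriv_of_nonneg' hder hnn hlim)
    ((ae_restrict_iff' measurableSet_Ioi).2 (ae_of_all _ hnn)),
    integral_Ioi_of_hasDerivAt_of_nonneg' hder hnn hlim]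
  simp [g]

/-- Coordinates for the orthogonal complement of the span of linearly independent vectors. -/
lemma exists_orthonormal_complement {d m : ℕ} {f : Fin d → Fin m → ℝ}
    (hf : LinearIndependent ℝ f) :
    ∃ W : Matrix (Fin m) (Fin (m - d)) ℝ, Wᵀ * W = 1 ∧ (∀ i, f i ᵥ* W = 0) ∧
      ∀ y : Fin m → ℝ, y ᵥ* W = 0 → ∃ c : Fin d → ℝ, y = ∑ i, c i • f i := by
  set e := WithLp.linearEquiv 2 ℝ (Fin m → ℝ)
  set F : Fin d → EuclideanSpace ℝ (Fin m) := fun i => e.symm (f i)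
  have hF : LinearIndependent ℝ F := hf.map' e.symm.toLinearMap e.symm.ker
  set K := Submodule.span ℝ (Set.range F)
  have hKd : Module.finrank ℝ K = d := by simpa using finrank_span_eq_card hF
  have hKo : Module.finrank ℝ Kᗮ = m - d := by
    have := K.finrank_add_finrank_orthogonal
    rw [hKd, finrank_euclideanSpace_fin] at this
    omega
  set b : OrthonormalBasis (Fin (m - d)) ℝ Kᗮ :=
    (stdOrthonormalBasis ℝ Kᗮ).reindex (finCongr hKo)
  have hinner : ∀ (y : Fin m → ℝ) (l : Fin (m - d)),
      (y ᵥ* (Matrix.of fun i l => (b l : EuclideanSpace ℝ (Fin m)) i)) l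
        = inner ℝ (b l : EuclideanSpace ℝ (Fin m)) (e.symm y) := by
    intro y l
    rw [PiLp.inner_apply]
    simp [vecMul, dotProduct, e]
  refine ⟨Matrix.of fun i l => (b l : EuclideanSpace ℝ (Fin m)) i, ?_, fun i => ?_, fun y hy => ?_⟩
  · ext l l'
    have h1 := hinner (fun i => (b l : EuclideanSpace ℝ (Fin m)) i) l'
    have h2 : (inner ℝ (b l' : EuclideanSpace ℝ (Fin m)) (b l : EuclideanSpace ℝ (Fin m)) : ℝ)
        = if l' = l then 1 else 0 := by
      have := orthonormal_iff_ite.1 b.orthonormal l' l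
      simpa using this
    rw [Matrix.mul_apply]
    simp only [transpose_apply]
    refine (Eq.trans ?_ h1).trans (Eq.trans ?_ (h2.trans ?_))
    · simp [vecMul, dotProduct]
    · congr 1
    · simp [Matrix.one_apply, eq_comm]
  · ext l
    rw [hinner]
    exact (Submodule.mem_orthogonal' K _).1 (b l).2 _ (Submodule.subset_span ⟨i, rfl⟩)
  · have hmem : e.symm y ∈ Kᗮᗮ := by
      rw [Submodule.mem_orthogonal]
      intro u hu
      have h0 : ∀ l, inner ℝ (b l : EuclideanSpace ℝ (Fin m)) (e.symm y) = 0 := fun l => by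
        rw [← hinner, hy]; rfl
      have hu' := congrArg (fun z : Kᗮ => (z : EuclideanSpace ℝ (Fin m))) (b.sum_repr ⟨u, hu⟩)
      simp only [Submodule.coe_sum, Submodule.coe_smul] at hu'
      rw [← hu', sum_inner]
      exact Finset.sum_eq_zero fun l _ => by rw [real_inner_smul_left, h0, mul_zero]
    rw [Submodule.orthogonal_orthogonal] at hmem
    obtain ⟨c, hc⟩ := (Submodule.mem_span_range_iff_exists_fun ℝ).1 hmem
    refine ⟨c, ?_⟩
    have := congrArg e hc
    simp only [map_sum, map_smul, F, LinearEquiv.apply_symm_apply] at this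
    exact this.symm

/-! ### The mean of an inverse Wishart matrix -/

/-- The diagonal entries of the inverse of a Gram matrix are the inverse squared distances of the
vectors to the span of the others. -/
lemma inv_mul_transpose_diag {d m : ℕ} {f : Fin d → Fin m → ℝ}
    {W : Matrix (Fin m) (Fin (m - d)) ℝ} (hW1 : Wᵀ * W = 1) (hW2 : ∀ i, f i ᵥ* W = 0)
    (hW3 : ∀ y : Fin m → ℝ, y ᵥ* W = 0 → ∃ c : Fin d → ℝ, y = ∑ i, c i • f i)
    {H : Matrix (Fin (d + 1)) (Fin m) ℝ} (j : Fin (d + 1)) (hH : ∀ i, H (j.succAbove i) = f i)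
    (hdet : (H * Hᵀ).det ≠ 0) :
    (H * Hᵀ)⁻¹ j j = ((H j ᵥ* W) ⬝ᵥ (H j ᵥ* W))⁻¹ := by
  set x : Fin m → ℝ := H j
  set s : ℝ := (x ᵥ* W) ⬝ᵥ (x ᵥ* W) with hs
  obtain ⟨c, hc⟩ := hW3 (x - W *ᵥ (x ᵥ* W)) (by
    rw [sub_vecMul, ← vecMul_transpose, vecMul_vecMul, vecMul_vecMul, hW1, Matrix.mul_one,
      sub_self])
  -- the component of `H j` orthogonal to the other rows, as a combination of the rows
  set a : Fin (d + 1) → ℝ := j.insertNth 1 (-c) with ha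
  have hu : a ᵥ* H = W *ᵥ (x ᵥ* W) := by
    have h1 : a ᵥ* H = ∑ i, a i • H i := by
      ext l; simp [vecMul, dotProduct]
    rw [h1, Fin.sum_univ_succAbove _ j]
    simp only [ha, Fin.insertNth_apply_same, Fin.insertNth_apply_succAbove, one_smul, hH,
      Pi.neg_apply, neg_smul, Finset.sum_neg_distrib, ← hc]
    change x + _ = _
    abel
  have hG : (H * Hᵀ) *ᵥ a = Pi.single j s := by
    rw [← mulVec_mulVec, mulVec_transpose, hu, mulVec_mulVec]
    ext i
    have h2 : ((H * W) *ᵥ (x ᵥ* W)) i = (H i ᵥ* W) ⬝ᵥ (x ᵥ* W) := by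
      simp only [mulVec, dotProduct, Matrix.mul_apply, vecMul]
    rw [h2]
    rcases Fin.eq_self_or_eq_succAbove j i with rfl | ⟨i, rfl⟩
    · simp [hs, x]
    · rw [hH, hW2, zero_dotProduct, Pi.single_eq_of_ne (Fin.succAbove_ne j i)]
  have hinv : (H * Hᵀ)⁻¹ *ᵥ Pi.single j s = a := by
    rw [← hG, mulVec_mulVec, nonsing_inv_mul _ (isUnit_iff_ne_zero.2 hdet), one_mulVec]
  have := congrFun hinv j
  rw [mulVec_single] at this
  simp [ha] at this
  exact eq_inv_of_mul_eq_one_left this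

lemma measurable_matrix_inv_apply {κ : Type*} [Fintype κ] [DecidableEq κ] (i j : κ) :
    Measurable fun M : κ → κ → ℝ => (Matrix.of M)⁻¹ i j := by
  have hc : Continuous fun M : κ → κ → ℝ => Matrix.of M := continuous_id
  simp only [Matrix.inv_def, Matrix.smul_apply, Ring.inverse_eq_inv', smul_eq_mul]
  exact hc.matrix_det.measurable.inv.mul (hc.matrix_adjugate.matrix_elem i j).measurable

lemma measurable_inv_mul_transpose {κ ι : Type*} [Fintype κ] [DecidableEq κ] [Fintype ι]
    (i j : κ) : Measurable fun H : κ → ι → ℝ => (Matrix.of H * (Matrix.of H)ᵀ)⁻¹ i j := by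
  have hc : Continuous fun H : κ → ι → ℝ => Matrix.of H := continuous_id
  have hm : Measurable fun H : κ → ι → ℝ =>
      (fun a b => (Matrix.of H * (Matrix.of H)ᵀ) a b : κ → κ → ℝ) :=
    measurable_pi_iff.2 fun a => measurable_pi_iff.2 fun b =>
      ((hc.matrix_mul hc.matrix_transpose).matrix_elem a b).measurable
  exact (measurable_matrix_inv_apply i j).comp hm

/-- The diagonal entries of an inverse Wishart matrix have mean `1 / (v (m - d - 1))`. -/
theorem lintegral_inv_mul_transpose_diag {d m : ℕ} (hdm : d + 1 < m) {v : ℝ≥0} (hv : v ≠ 0)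
    (j : Fin d) :
    ∫⁻ H, ENNReal.ofReal ((Matrix.of H * (Matrix.of H)ᵀ)⁻¹ j j)
        ∂(Measure.pi fun _ : Fin d => gaussianVec (Fin m) v)
      = ENNReal.ofReal (1 / (v * ((m : ℝ) - d - 1))) := by
  obtain _ | d := d
  · exact j.elim0
  have hmp := (measurePreserving_piFinSuccAbove
    (fun _ : Fin (d + 1) => gaussianVec (Fin m) v) j).symm
  set Φ := MeasurableEquiv.piFinSuccAbove (fun _ : Fin (d + 1) => Fin m → ℝ) j
  have hmeas : Measurable fun H : Fin (d + 1) → Fin m → ℝ =>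
      ENNReal.ofReal ((Matrix.of H * (Matrix.of H)ᵀ)⁻¹ j j) :=
    (measurable_inv_mul_transpose j j).ennreal_ofReal
  have hLI : ∀ᵐ z ∂((gaussianVec (Fin m) v).prod
      (Measure.pi fun _ : Fin d => gaussianVec (Fin m) v)), LinearIndependent ℝ (Φ.symm z) :=
    hmp.quasiMeasurePreserving.ae (ae_linearIndependent_gaussianVec hv (d + 1) (by omega))
  rw [← Measure.prod_swap, ae_map_iff measurable_swap.aemeasurable (show
    MeasurableSet {z | LinearIndependent ℝ (Φ.symm z)} from
    (measurableSet_linearIndependent (d + 1) m).preimage hmp.measurable)] at hLI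
  have hLI' := Measure.ae_ae_of_ae_prod hLI
  rw [← hmp.lintegral_comp hmeas, lintegral_prod_symm _
    (show Measurable fun z => ENNReal.ofReal
        ((Matrix.of (Φ.symm z) * (Matrix.of (Φ.symm z))ᵀ)⁻¹ j j) from
      hmeas.comp hmp.measurable).aemeasurable]
  have hinner : ∀ᵐ f ∂(Measure.pi fun _ : Fin d => gaussianVec (Fin m) v),
      ∫⁻ x, ENNReal.ofReal
        ((Matrix.of (Φ.symm (x, f)) * (Matrix.of (Φ.symm (x, f)))ᵀ)⁻¹ j j)
          ∂(gaussianVec (Fin m) v)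
        = ENNReal.ofReal (1 / (v * (((m : ℝ) - (d + 1 : ℕ) - 1)))) := by
    filter_upwards [hLI', ae_linearIndependent_gaussianVec hv d (by omega)] with f hf hf0
    obtain ⟨W, hW1, hW2, hW3⟩ := exists_orthonormal_complement hf0
    have heq : ∀ᵐ x ∂(gaussianVec (Fin m) v), ENNReal.ofReal
        ((Matrix.of (Φ.symm (x, f)) * (Matrix.of (Φ.symm (x, f)))ᵀ)⁻¹ j j)
        = ENNReal.ofReal (((x ᵥ* W) ⬝ᵥ (x ᵥ* W))⁻¹) := by
      filter_upwards [hf] with x hx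
      have hrow : ∀ i, (Φ.symm (x, f)) (j.succAbove i) = f i := fun i => by
        have := congrFun (congrArg Prod.snd (Φ.apply_symm_apply (x, f))) i
        exact this
      have hj : (Φ.symm (x, f)) j = x := congrArg Prod.fst (Φ.apply_symm_apply (x, f))
      rw [inv_mul_transpose_diag hW1 hW2 hW3 (H := Matrix.of (Φ.symm (x, f))) j hrow
        ((det_mul_transpose_ne_zero_iff _).2 hx)]
      change ENNReal.ofReal ((((Φ.symm (x, f)) j ᵥ* W) ⬝ᵥ ((Φ.symm (x, f)) j ᵥ* W))⁻¹) = _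
      rw [hj]
    rw [lintegral_congr_ae heq]
    have hdot : Measurable fun y : Fin (m - d) → ℝ => ENNReal.ofReal ((y ⬝ᵥ y)⁻¹) := by
      unfold dotProduct
      fun_prop
    have := (measurePreserving_vecMul_gaussianVec v hW1).lintegral_comp hdot
    rw [this, lintegral_inv_dotProduct_self (by omega) hv, Nat.cast_sub (by omega)]
    congr 3
    push_cast
    ring
  rw [lintegral_congr_ae hinner, lintegral_const, measure_univ, mul_one]

/-! ### Least squares and the law of the sketched data -/

lemma lsCost_eq_dotProduct {n d : ℕ} (A : Matrix (Fin n) (Fin d) ℝ) (b : Fin n → ℝ)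
    (x : Fin d → ℝ) : lsCost A b x = (A *ᵥ x - b) ⬝ᵥ (A *ᵥ x - b) := by
  rw [lsCost, EuclideanSpace.norm_sq_eq]
  simp [dotProduct, sq]

lemma lsCost_nonneg {n d : ℕ} (A : Matrix (Fin n) (Fin d) ℝ) (b : Fin n → ℝ)
    (x : Fin d → ℝ) : 0 ≤ lsCost A b x := sq_nonneg _

lemma lsCost_add {n d : ℕ} (A : Matrix (Fin n) (Fin d) ℝ) (b : Fin n → ℝ) (x z : Fin d → ℝ) :
    lsCost A b (x + z)
      = lsCost A b x + 2 * (z ⬝ᵥ Aᵀ *ᵥ (A *ᵥ x - b)) + (A *ᵥ z) ⬝ᵥ (A *ᵥ z) := by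
  rw [lsCost_eq_dotProduct, lsCost_eq_dotProduct, mulVec_add,
    show A *ᵥ x + A *ᵥ z - b = (A *ᵥ x - b) + A *ᵥ z by abel,
    dotProduct_mulVec z, vecMul_transpose]
  simp only [add_dotProduct, dotProduct_add, dotProduct_comm _ (A *ᵥ z)]
  ring

lemma dotProduct_self_nonneg' {α : Type*} [Fintype α] (x : α → ℝ) : 0 ≤ x ⬝ᵥ x :=
  Finset.sum_nonneg fun _ _ => mul_self_nonneg _

/-- Least squares solutions are the solutions of the normal equations. -/
lemma isLeastSquaresSol_iff {n d : ℕ} {A : Matrix (Fin n) (Fin d) ℝ} {b : Fin n → ℝ}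
    {x : Fin d → ℝ} : IsLeastSquaresSol A b x ↔ Aᵀ *ᵥ (A *ᵥ x - b) = 0 := by
  constructor
  · intro h
    refine dotProduct_eq_zero _ fun z => ?_
    rw [dotProduct_comm]
    have h1 : ∀ t : ℝ, 0 ≤ ((A *ᵥ z) ⬝ᵥ (A *ᵥ z)) * (t * t)
        + (2 * (z ⬝ᵥ Aᵀ *ᵥ (A *ᵥ x - b))) * t + 0 := by
      intro t
      have := h (x + t • z)
      rw [lsCost_add, mulVec_smul, smul_dotProduct, smul_dotProduct, dotProduct_smul] at this
      simp only [smul_eq_mul] at this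
      linarith
    have := discrim_le_zero h1
    rw [discrim] at this
    nlinarith
  · intro h z
    have := lsCost_add A b x (z - x)
    rw [h, dotProduct_zero, add_sub_cancel] at this
    rw [this]
    linarith [dotProduct_self_nonneg' (A *ᵥ (z - x))]

lemma posDef_transpose_mul_self_of_rank {n d : ℕ} {A : Matrix (Fin n) (Fin d) ℝ}
    (hA : A.rank = d) : (Aᵀ * A).PosDef := by
  have h : LinearIndependent ℝ A.col := by
    rw [linearIndependent_iff_card_eq_finrank_span, Fintype.card_fin]
    rw [rank_eq_finrank_span_cols] at hA
    exact hA.symm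
  rw [← mulVec_injective_iff] at h
  have := PosDef.conjTranspose_mul_self A h
  rwa [conjTranspose_eq_transpose_of_trivial] at this

lemma rank_eq_of_det_ne_zero {n d : ℕ} {A : Matrix (Fin n) (Fin d) ℝ}
    (hA : (Aᵀ * A).det ≠ 0) : A.rank = d := by
  rw [← rank_transpose_mul_self, rank_of_isUnit, Fintype.card_fin]
  exact (isUnit_iff_isUnit_det _).2 (isUnit_iff_ne_zero.2 hA)

/-- The explicit least squares solution `(Mᵀ M)⁻¹ Mᵀ y`; it is only meaningful if `M` has full
column rank, as the inverse of a singular matrix is `0`. -/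
noncomputable def leastSquaresEstimator (m d : ℕ) : Estimator m d :=
  fun M y => (Mᵀ * M)⁻¹ *ᵥ (Mᵀ *ᵥ y)

lemma isLeastSquaresSol_iff_eq {m d : ℕ} {M : Matrix (Fin m) (Fin d) ℝ} {y : Fin m → ℝ}
    (hM : (Mᵀ * M).det ≠ 0) {x : Fin d → ℝ} :
    IsLeastSquaresSol M y x ↔ x = leastSquaresEstimator m d M y := by
  have hu : IsUnit (Mᵀ * M).det := isUnit_iff_ne_zero.2 hM
  rw [isLeastSquaresSol_iff, mulVec_sub, sub_eq_zero, mulVec_mulVec, leastSquaresEstimator]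
  constructor
  · intro h
    rw [← h, mulVec_mulVec, nonsing_inv_mul _ hu, one_mulVec]
  · rintro rfl
    rw [mulVec_mulVec, mul_nonsing_inv _ hu, one_mulVec]

/-- The matrix `[A b]`, with the column `b` indexed by `none`. -/
def augment {n d : ℕ} (A : Matrix (Fin n) (Fin d) ℝ) (b : Fin n → ℝ) :
    Matrix (Fin n) (Option (Fin d)) ℝ :=
  Matrix.of fun i c => c.elim (b i) (A i)

/-- The `k`-th sketched matrix in an array of sketched data `[Sₖ A, Sₖ b]`. -/
def blockMatrix {q m d : ℕ} (z : Option (Fin d) × (Fin q × Fin m) → ℝ) (k : Fin q) :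
    Matrix (Fin m) (Fin d) ℝ :=
  Matrix.of fun i j => z (some j, (k, i))

/-- The `k`-th sketched vector in an array of sketched data `[Sₖ A, Sₖ b]`. -/
def blockVector {q m d : ℕ} (z : Option (Fin d) × (Fin q × Fin m) → ℝ) (k : Fin q) :
    Fin m → ℝ :=
  fun i => z (none, (k, i))

/-- The average of the estimates computed from the blocks of an array of sketched data. -/
noncomputable def arrayEstimate {q m d : ℕ} (g : Fin q → Estimator m d)
    (z : Option (Fin d) × (Fin q × Fin m) → ℝ) : Fin d → ℝ :=
  (q : ℝ)⁻¹ • ∑ k, g k (blockMatrix z k) (blockVector z k)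

/-- The entries of all the sketching matrices as one Gaussian vector. -/
def sketchEntries {Ω : Type*} {q m n : ℕ} (S : Fin q → Ω → Matrix (Fin m) (Fin n) ℝ) (ω : Ω) :
    Fin n × (Fin q × Fin m) → ℝ :=
  fun p => S p.2.1 ω p.2.2 p.1

lemma blockMatrix_sketchEntries {Ω : Type*} {q m n d : ℕ}
    (S : Fin q → Ω → Matrix (Fin m) (Fin n) ℝ) (A : Fin q → Matrix (Fin n) (Fin d) ℝ)
    (b : Fin q → Fin n → ℝ) (ω : Ω) (k : Fin q) :
    blockMatrix (sketchEntries S ω ᵥ*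
      blockDiagonal fun i : Fin q × Fin m => augment (A i.1) (b i.1)) k = S k ω * A k := by
  ext i j
  rw [blockMatrix, of_apply, vecMul_blockDiagonal_apply]
  simp [sketchEntries, vecMul, dotProduct, augment, Matrix.mul_apply]

lemma blockVector_sketchEntries {Ω : Type*} {q m n d : ℕ}
    (S : Fin q → Ω → Matrix (Fin m) (Fin n) ℝ) (A : Fin q → Matrix (Fin n) (Fin d) ℝ)
    (b : Fin q → Fin n → ℝ) (ω : Ω) (k : Fin q) :
    blockVector (sketchEntries S ω ᵥ*
      blockDiagonal fun i : Fin q × Fin m => augment (A i.1) (b i.1)) k = S k ω *ᵥ b k := by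
  ext i
  rw [blockVector, vecMul_blockDiagonal_apply]
  simp [sketchEntries, vecMul, dotProduct, augment, mulVec]

lemma averagedEstimate_eq {Ω : Type*} {q m n d : ℕ} (S : Fin q → Ω → Matrix (Fin m) (Fin n) ℝ)
    (g : Fin q → Estimator m d) (A : Matrix (Fin n) (Fin d) ℝ) (b : Fin n → ℝ) (ω : Ω) :
    averagedEstimate g A b (fun k => S k ω) = arrayEstimate g (sketchEntries S ω ᵥ*
      blockDiagonal fun _ : Fin q × Fin m => augment A b) := by
  rw [averagedEstimate, arrayEstimate]
  congr 1
  refine Finset.sum_congr rfl fun k _ => ?_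
  rw [blockMatrix_sketchEntries S (fun _ => A) (fun _ => b),
    blockVector_sketchEntries S (fun _ => A) (fun _ => b), estimate]

section Law

variable {Ω : Type*} [MeasurableSpace Ω] {P : Measure Ω} {q m n : ℕ}
  {S : Fin q → Ω → Matrix (Fin m) (Fin n) ℝ}

lemma IsGaussianSketch.aemeasurable_sketchEntries (hS : IsGaussianSketch P S) :
    AEMeasurable (sketchEntries S) P :=
  aemeasurable_pi_iff.2 fun p => (hS.law p.2.1 p.2.2 p.1).aemeasurable

lemma IsGaussianSketch.map_sketchEntries [IsProbabilityMeasure P] (hS : IsGaussianSketch P S) :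
    P.map (sketchEntries S) = gaussianVec (Fin n × (Fin q × Fin m)) (m : ℝ≥0)⁻¹ := by
  have hinj : Function.Injective
      fun p : Fin n × (Fin q × Fin m) => (p.2.1, p.2.2, p.1) := by
    rintro ⟨a, b, c⟩ ⟨a', b', c'⟩ h
    simp only [Prod.mk.injEq] at h
    simp [h]
  have hind := hS.indep.precomp hinj
  have := hind.map_fun_eq_pi_map
    fun p : Fin n × (Fin q × Fin m) => (hS.law p.2.1 p.2.2 p.1).aemeasurable
  refine Eq.trans this ?_
  congr 1
  funext p
  exact (hS.law p.2.1 p.2.2 p.1).map_eq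

/-- The sketched data `Sₖ Bₖ` depend in law only on the Gram matrices of the `Bₖ`. -/
lemma IsGaussianSketch.map_vecMul_blockDiagonal [IsProbabilityMeasure P]
    (hS : IsGaussianSketch P S) {κ κ' : Type*}
    [Fintype κ] [Fintype κ'] [DecidableEq κ] {B : Fin q × Fin m → Matrix (Fin n) κ ℝ}
    {R : Fin q × Fin m → Matrix κ' κ ℝ} (h : ∀ i, (B i)ᵀ * B i = (R i)ᵀ * R i) :
    P.map (fun ω => sketchEntries S ω ᵥ* blockDiagonal B)
      = (gaussianVec (κ' × (Fin q × Fin m)) (m : ℝ≥0)⁻¹).map (fun s => s ᵥ* blockDiagonal R) := by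
  rw [← map_vecMul_gaussianVec_congr (C := blockDiagonal B), ← hS.map_sketchEntries,
    AEMeasurable.map_map_of_aemeasurable (measurable_vecMul_const _).aemeasurable
      hS.aemeasurable_sketchEntries]
  · rfl
  · rw [blockDiagonal_transpose, blockDiagonal_transpose, ← blockDiagonal_mul,
      ← blockDiagonal_mul]
    congr 1
    funext i
    exact h i

end Law

/-- A square root of the Gram matrix of `[A b]`, in terms of one of `Aᵀ A`, the least squares
solution `x` and the residual norm `σ`. -/
def augmentRoot {d : ℕ} (R : Matrix (Fin d) (Fin d) ℝ) (x : Fin d → ℝ) (σ : ℝ) :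
    Matrix (Option (Fin d)) (Option (Fin d)) ℝ :=
  Matrix.of fun c c' => c.elim (c'.elim σ fun _ => 0)
    (fun i => c'.elim ((R *ᵥ x) i) fun j => R i j)

lemma augment_gram_eq {n d : ℕ} {A : Matrix (Fin n) (Fin d) ℝ} {b : Fin n → ℝ} {x : Fin d → ℝ}
    (hx : IsLeastSquaresSol A b x) {R : Matrix (Fin d) (Fin d) ℝ} (hR : Rᵀ * R = Aᵀ * A)
    {σ : ℝ} (hσ : σ ^ 2 = lsCost A b x) :
    (augment A b)ᵀ * augment A b = (augmentRoot R x σ)ᵀ * augmentRoot R x σ := by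
  have hn := isLeastSquaresSol_iff.1 hx
  have h1 : ∀ j, ∑ i, A i j * b i = ∑ i, R i j * (R *ᵥ x) i := by
    intro j
    have h2 : Aᵀ *ᵥ b = Rᵀ *ᵥ (R *ᵥ x) := by
      rw [mulVec_sub, sub_eq_zero] at hn
      rw [← hn, mulVec_mulVec, mulVec_mulVec, hR]
    exact congrFun h2 j
  have h3 : b ⬝ᵥ b = (R *ᵥ x) ⬝ᵥ (R *ᵥ x) + σ ^ 2 := by
    have e1 : (R *ᵥ x) ⬝ᵥ (R *ᵥ x) = x ⬝ᵥ (Rᵀ * R) *ᵥ x := by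
      rw [← mulVec_mulVec, dotProduct_mulVec x, vecMul_transpose]
    have e2 : (A *ᵥ x) ⬝ᵥ (A *ᵥ x) = x ⬝ᵥ (Aᵀ * A) *ᵥ x := by
      rw [← mulVec_mulVec, dotProduct_mulVec x, vecMul_transpose]
    have e3 : (A *ᵥ x) ⬝ᵥ (A *ᵥ x - b) = 0 := by
      have := dotProduct_mulVec x Aᵀ (A *ᵥ x - b)
      rwa [hn, dotProduct_zero, vecMul_transpose, eq_comm] at this
    rw [hσ, lsCost_eq_dotProduct, e1, hR, ← e2]
    simp only [sub_dotProduct, dotProduct_sub] at e3 ⊢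
    rw [dotProduct_comm b (A *ᵥ x)]
    linarith
  have hA : ∀ i j, ∑ k, A k i * A k j = ∑ k, R k i * R k j := fun i j =>
    (congrFun (congrFun hR i) j).symm
  ext c c'
  simp only [Matrix.mul_apply, transpose_apply, Fintype.sum_option]
  rcases c with _ | i <;> rcases c' with _ | j
  · simp only [augment, augmentRoot, of_apply, Option.elim]
    rw [show ∑ i, b i * b i = b ⬝ᵥ b from rfl, h3, dotProduct]
    ring
  · simp only [augment, augmentRoot, of_apply, Option.elim, mul_zero, zero_add]
    simp_rw [mul_comm (b _), mul_comm ((R *ᵥ x) _)]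
    exact h1 j
  · simp only [augment, augmentRoot, of_apply, Option.elim, zero_mul, zero_add]
    exact h1 i
  · simp only [augment, augmentRoot, of_apply, Option.elim, zero_mul, zero_add]
    exact hA i j

lemma blockMatrix_augmentRoot {q m d : ℕ} (R : Matrix (Fin d) (Fin d) ℝ) (x : Fin d → ℝ) (σ : ℝ)
    (s : Option (Fin d) × (Fin q × Fin m) → ℝ) (k : Fin q) :
    blockMatrix (s ᵥ* blockDiagonal fun _ => augmentRoot R x σ) k = blockMatrix s k * R := by
  ext i j
  rw [blockMatrix, of_apply, vecMul_blockDiagonal_apply]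
  simp [blockMatrix, vecMul, dotProduct, augmentRoot, Matrix.mul_apply, Fintype.sum_option]

lemma blockVector_augmentRoot {q m d : ℕ} (R : Matrix (Fin d) (Fin d) ℝ) (x : Fin d → ℝ) (σ : ℝ)
    (s : Option (Fin d) × (Fin q × Fin m) → ℝ) (k : Fin q) :
    blockVector (s ᵥ* blockDiagonal fun _ => augmentRoot R x σ) k
      = blockMatrix s k *ᵥ (R *ᵥ x) + σ • blockVector s k := by
  ext i
  rw [blockVector, vecMul_blockDiagonal_apply]
  simp only [vecMul, dotProduct, Fintype.sum_option, augmentRoot, of_apply, Option.elim,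
    Pi.add_apply, Pi.smul_apply, smul_eq_mul, blockVector, blockMatrix, mulVec]
  ring

lemma measurable_estimate_block {q m d : ℕ} {g : Estimator m d} (hg : g.IsMeasurable)
    (k : Fin q) : Measurable fun z : Option (Fin d) × (Fin q × Fin m) → ℝ =>
      g (blockMatrix z k) (blockVector z k) := by
  have h1 : Measurable fun z : Option (Fin d) × (Fin q × Fin m) → ℝ =>
      ((fun i j => z (some j, (k, i)), fun i => z (none, (k, i))) :
        (Fin m → Fin d → ℝ) × (Fin m → ℝ)) := by
    refine Measurable.prodMk ?_ ?_
    · exact measurable_pi_iff.2 fun i => measurable_pi_iff.2 fun j => measurable_pi_apply _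
    · exact measurable_pi_iff.2 fun i => measurable_pi_apply _
  exact hg.comp h1

lemma measurable_arrayEstimate {q m d : ℕ} {g : Fin q → Estimator m d}
    (hg : ∀ k, (g k).IsMeasurable) : Measurable (arrayEstimate g) := by
  have h1 : Measurable fun z => ∑ k, g k (blockMatrix z k) (blockVector z k) :=
    Finset.measurable_fun_sum _ fun k _ => measurable_estimate_block (hg k) k
  exact h1.const_smul ((q : ℝ)⁻¹)

lemma measurable_mulVec_const {α β : Type*} [Fintype β] (R : Matrix α β ℝ) :
    Measurable fun x : β → ℝ => R *ᵥ x := by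
  unfold mulVec dotProduct
  fun_prop

/-- The expected error in terms of a canonical Gaussian array: the data are then
`(Gₖ R, Gₖ R x + σ ξₖ)`, where the entries of `Gₖ` and `ξₖ` are independent and `N(0, 1/m)`. -/
lemma IsGaussianSketch.expectedError_eq {Ω : Type*} [MeasurableSpace Ω] {P : Measure Ω}
    [IsProbabilityMeasure P] {q m n d : ℕ} {S : Fin q → Ω → Matrix (Fin m) (Fin n) ℝ}
    (hS : IsGaussianSketch P S) {g : Fin q → Estimator m d} (hg : ∀ k, (g k).IsMeasurable)
    {A : Matrix (Fin n) (Fin d) ℝ} {b : Fin n → ℝ} {x : Fin d → ℝ}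
    (hx : IsLeastSquaresSol A b x) {R : Matrix (Fin d) (Fin d) ℝ} (hR : Rᵀ * R = Aᵀ * A)
    {σ : ℝ} (hσ : σ ^ 2 = lsCost A b x) :
    expectedError P S g A b x
      = ∫⁻ s, ENNReal.ofReal
          ((R *ᵥ (arrayEstimate g (s ᵥ* blockDiagonal fun _ => augmentRoot R x σ) - x)) ⬝ᵥ
            (R *ᵥ (arrayEstimate g (s ᵥ* blockDiagonal fun _ => augmentRoot R x σ) - x)))
        ∂(gaussianVec (Option (Fin d) × (Fin q × Fin m)) (m : ℝ≥0)⁻¹) := by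
  have hcost : ∀ y, lsCost A b y = (R *ᵥ (y - x)) ⬝ᵥ (R *ᵥ (y - x)) + lsCost A b x := by
    intro y
    have := lsCost_add A b x (y - x)
    rw [isLeastSquaresSol_iff.1 hx, dotProduct_zero, add_sub_cancel] at this
    have e1 : ∀ z, (R *ᵥ z) ⬝ᵥ (R *ᵥ z) = (A *ᵥ z) ⬝ᵥ (A *ᵥ z) := fun z => by
      have e1 : (R *ᵥ z) ⬝ᵥ (R *ᵥ z) = z ⬝ᵥ (Rᵀ * R) *ᵥ z := by
        rw [← mulVec_mulVec, dotProduct_mulVec z, vecMul_transpose]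
      have e2 : (A *ᵥ z) ⬝ᵥ (A *ᵥ z) = z ⬝ᵥ (Aᵀ * A) *ᵥ z := by
        rw [← mulVec_mulVec, dotProduct_mulVec z, vecMul_transpose]
      rw [e1, e2, hR]
    rw [this, e1]
    ring
  rw [expectedError, expectedCost]
  simp_rw [hcost (averagedEstimate _ _ _ _), ENNReal.ofReal_add (dotProduct_self_nonneg' _)
    (lsCost_nonneg A b x)]
  rw [lintegral_add_right _ measurable_const, lintegral_const, measure_univ, mul_one,
    ENNReal.add_sub_cancel_right ENNReal.ofReal_ne_top]
  simp_rw [averagedEstimate_eq]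
  have hlaw := hS.map_vecMul_blockDiagonal (B := fun _ => augment A b)
    (R := fun _ => augmentRoot R x σ) fun _ => augment_gram_eq hx hR hσ
  set F : (Option (Fin d) × (Fin q × Fin m) → ℝ) → ℝ≥0∞ := fun z =>
    ENNReal.ofReal ((R *ᵥ (arrayEstimate g z - x)) ⬝ᵥ (R *ᵥ (arrayEstimate g z - x)))
  have hF : Measurable F := by
    have h1 : Measurable fun z => R *ᵥ (arrayEstimate g z - x) :=
      (measurable_mulVec_const R).comp ((measurable_arrayEstimate hg).sub_const x)
    have h2 : Measurable fun y : Fin d → ℝ => y ⬝ᵥ y := by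
      unfold dotProduct; fun_prop
    exact (h2.comp h1).ennreal_ofReal
  have h1 := lintegral_map' (μ := P) (f := F)
    (g := fun ω => sketchEntries S ω ᵥ* blockDiagonal fun _ => augment A b) hF.aemeasurable
    ((measurable_vecMul_const _).comp_aemeasurable hS.aemeasurable_sketchEntries)
  rw [← h1, hlaw, lintegral_map hF (measurable_vecMul_const _)]

/-! ### Moments of least squares in canonical coordinates -/

lemma measurePreserving_curry_gaussianVec (α β : Type*) [Fintype α] [Fintype β] (v : ℝ≥0) :
    MeasurePreserving (MeasurableEquiv.curry α β ℝ) (gaussianVec (α × β) v)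
      (Measure.pi fun _ : α => gaussianVec β v) := by
  refine MeasurePreserving.symm (MeasurableEquiv.curry α β ℝ).symm
    ⟨(MeasurableEquiv.curry α β ℝ).symm.measurable, ?_⟩
  refine (Measure.pi_eq fun s hs => ?_).symm
  rw [MeasurableEquiv.map_apply]
  have : (MeasurableEquiv.curry α β ℝ).symm ⁻¹' Set.univ.pi s
      = Set.univ.pi fun a => Set.univ.pi fun b => s (a, b) := by
    ext H
    simp [MeasurableEquiv.curry, Set.mem_pi, Function.uncurry]
  rw [this, Measure.pi_pi]
  simp_rw [Measure.pi_pi]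
  rw [Fintype.prod_prod_type]

/-- The array with rows `(Gᵢ, ξᵢ)`. -/
def joinArray {κ ι : Type*} (p : (κ × ι → ℝ) × (ι → ℝ)) : Option κ × ι → ℝ :=
  fun c => c.1.elim (p.2 c.2) fun j => p.1 (j, c.2)

lemma measurePreserving_joinArray (κ ι : Type*) [Fintype κ] [Fintype ι] (v : ℝ≥0) :
    MeasurePreserving joinArray ((gaussianVec (κ × ι) v).prod (gaussianVec ι v))
      (gaussianVec (Option κ × ι) v) := by
  have h1 := (measurePreserving_sumPiEquivProdPi_symm
    (fun _ : (κ × ι) ⊕ ι => gaussianReal 0 v))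
  have hinj : Function.Injective fun c : Option κ × ι =>
      (c.1.elim (Sum.inr c.2) fun j => Sum.inl (j, c.2) : (κ × ι) ⊕ ι) := by
    rintro ⟨_ | a, i⟩ ⟨_ | b, j⟩ h <;> simp_all
  have h2 := (measurePreserving_comp_gaussianVec v hinj).comp h1
  convert! h2 using 1
  ext p c
  rcases c with ⟨_ | a, i⟩ <;> rfl

lemma isMeasurable_leastSquaresEstimator (m d : ℕ) :
    (leastSquaresEstimator m d).IsMeasurable := by
  have hinv : ∀ i j, Measurable fun p : (Fin m → Fin d → ℝ) × (Fin m → ℝ) =>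
      ((Matrix.of p.1)ᵀ * Matrix.of p.1)⁻¹ i j := by
    intro i j
    have hT : Measurable fun p : (Fin m → Fin d → ℝ) × (Fin m → ℝ) =>
        (fun j i => p.1 i j : Fin d → Fin m → ℝ) := by fun_prop
    exact (measurable_inv_mul_transpose i j).comp hT
  refine measurable_pi_iff.2 fun j => ?_
  simp only [leastSquaresEstimator, mulVec, dotProduct]
  refine Finset.measurable_fun_sum _ fun i _ => (hinv j i).mul ?_
  simp only [transpose_apply, of_apply]
  fun_prop

/-- In canonical coordinates the error of the least squares estimator does not depend on the
solution `x`. -/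
lemma mulVec_leastSquaresEstimator_sub {m d : ℕ} {G : Matrix (Fin m) (Fin d) ℝ}
    (hG : (Gᵀ * G).det ≠ 0) {R : Matrix (Fin d) (Fin d) ℝ} (hR : IsUnit R) (x : Fin d → ℝ)
    (σ : ℝ) (ξ : Fin m → ℝ) :
    R *ᵥ (leastSquaresEstimator m d (G * R) (G *ᵥ (R *ᵥ x) + σ • ξ) - x)
      = σ • leastSquaresEstimator m d G ξ := by
  have hRd : IsUnit R.det := (isUnit_iff_isUnit_det _).1 hR
  have hGR : ((G * R)ᵀ * (G * R)).det ≠ 0 := by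
    rw [transpose_mul, show Rᵀ * Gᵀ * (G * R) = Rᵀ * (Gᵀ * G) * R by
      simp only [Matrix.mul_assoc], det_mul, det_mul, det_transpose]
    exact mul_ne_zero (mul_ne_zero hRd.ne_zero hG) hRd.ne_zero
  set e := leastSquaresEstimator m d G ξ
  have he : Gᵀ *ᵥ (G *ᵥ e - ξ) = 0 :=
    isLeastSquaresSol_iff.1 ((isLeastSquaresSol_iff_eq hG).2 rfl)
  have hRe : R *ᵥ (R⁻¹ *ᵥ (σ • e)) = σ • e := by
    rw [mulVec_mulVec, mul_nonsing_inv _ hRd, one_mulVec]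
  have h1 : x + R⁻¹ *ᵥ (σ • e)
      = leastSquaresEstimator m d (G * R) (G *ᵥ (R *ᵥ x) + σ • ξ) := by
    refine (isLeastSquaresSol_iff_eq hGR).1 (isLeastSquaresSol_iff.2 ?_)
    rw [← mulVec_mulVec, mulVec_add R, hRe, transpose_mul, ← mulVec_mulVec,
      show G *ᵥ (R *ᵥ x + σ • e) - (G *ᵥ (R *ᵥ x) + σ • ξ) = σ • (G *ᵥ e - ξ) by
        rw [mulVec_add, mulVec_smul, smul_sub]; abel, mulVec_smul, he, smul_zero, mulVec_zero]
  rw [← h1, add_sub_cancel_left, hRe]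

/-- The `k`-th block of a canonical array. -/
def canonicalBlock {q m d : ℕ} (G : Fin d × (Fin q × Fin m) → ℝ) (k : Fin q) :
    Matrix (Fin m) (Fin d) ℝ :=
  Matrix.of fun i j => G (j, (k, i))

lemma blockMatrix_joinArray {q m d : ℕ} (p : (Fin d × (Fin q × Fin m) → ℝ) × (Fin q × Fin m → ℝ))
    (k : Fin q) : blockMatrix (joinArray p) k = canonicalBlock p.1 k := rfl

lemma blockVector_joinArray {q m d : ℕ} (p : (Fin d × (Fin q × Fin m) → ℝ) × (Fin q × Fin m → ℝ))
    (k : Fin q) : blockVector (joinArray p) k = fun i => p.2 (k, i) := rfl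

lemma measurePreserving_columns {q m d : ℕ} (v : ℝ≥0) (k : Fin q) :
    MeasurePreserving (fun (G : Fin d × (Fin q × Fin m) → ℝ) (j : Fin d) (i : Fin m) =>
      G (j, (k, i))) (gaussianVec (Fin d × (Fin q × Fin m)) v)
      (Measure.pi fun _ : Fin d => gaussianVec (Fin m) v) := by
  have hinj : Function.Injective fun p : Fin d × Fin m => (p.1, (k, p.2)) := by
    rintro ⟨a, b⟩ ⟨c, d⟩ h
    simpa using h
  exact (measurePreserving_curry_gaussianVec (Fin d) (Fin m) v).comp
    (measurePreserving_comp_gaussianVec v hinj)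

lemma ae_det_blockMatrix_ne_zero {q m d : ℕ} (hdm : d ≤ m) {v : ℝ≥0} (hv : v ≠ 0) (k : Fin q) :
    ∀ᵐ s ∂(gaussianVec (Option (Fin d) × (Fin q × Fin m)) v),
      ((blockMatrix s k)ᵀ * blockMatrix s k).det ≠ 0 := by
  have hinj : Function.Injective fun p : Fin d × (Fin q × Fin m) =>
      ((some p.1, p.2) : Option (Fin d) × (Fin q × Fin m)) := by
    rintro ⟨a, b⟩ ⟨c, d⟩ h
    simpa using h
  have h1 := ((measurePreserving_columns v k).comp
    (measurePreserving_comp_gaussianVec v hinj)).quasiMeasurePreserving.ae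
      (ae_linearIndependent_gaussianVec hv d hdm)
  filter_upwards [h1] with s hs
  exact (det_mul_transpose_ne_zero_iff (blockMatrix s k)ᵀ).2 hs

lemma inv_mul_mul_inv_self {κ : Type*} [Fintype κ] [DecidableEq κ] (M : Matrix κ κ ℝ) :
    M⁻¹ * M * M⁻¹ = M⁻¹ := by
  by_cases h : IsUnit M.det
  · rw [nonsing_inv_mul _ h, Matrix.one_mul]
  · simp [nonsing_inv_apply_not_isUnit _ h]

/-- The squared norm of a row of the pseudoinverse `(Gᵀ G)⁻¹ Gᵀ`. -/
lemma sum_sq_pseudoinverse {m d : ℕ} (G : Matrix (Fin m) (Fin d) ℝ) (j : Fin d) :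
    ∑ i, (((Gᵀ * G)⁻¹ * Gᵀ) j i) ^ 2 = (Gᵀ * G)⁻¹ j j := by
  have h1 : ((Gᵀ * G)⁻¹ * Gᵀ) * ((Gᵀ * G)⁻¹ * Gᵀ)ᵀ = (Gᵀ * G)⁻¹ := by
    rw [transpose_mul, transpose_transpose, transpose_nonsing_inv, transpose_mul,
      transpose_transpose, ← Matrix.mul_assoc, Matrix.mul_assoc _ Gᵀ G, inv_mul_mul_inv_self]
  have h2 := congrFun (congrFun h1 j) j
  rw [Matrix.mul_apply] at h2
  rw [← h2]
  exact Finset.sum_congr rfl fun i _ => by rw [transpose_apply, sq]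

/-- The second moments of weighted sums of the canonical least squares errors. -/
theorem lintegral_sq_sum_leastSquaresEstimator {q m d : ℕ} (hdm : d + 1 < m) (w : Fin q → ℝ)
    (j : Fin d) :
    ∫⁻ s, ENNReal.ofReal
        ((∑ k, w k * leastSquaresEstimator m d (blockMatrix s k) (blockVector s k) j) ^ 2)
        ∂(gaussianVec (Option (Fin d) × (Fin q × Fin m)) (m : ℝ≥0)⁻¹)
      = ENNReal.ofReal ((∑ k, w k ^ 2) / ((m : ℝ) - d - 1)) := by
  have hm0 : (m : ℝ≥0) ≠ 0 := by
    have : m ≠ 0 := by omega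
    exact_mod_cast this
  have hv : (m : ℝ≥0)⁻¹ ≠ 0 := inv_ne_zero hm0
  have hmr : (0 : ℝ) < m := by
    have : 0 < m := by omega
    exact_mod_cast this
  have hpos : (0 : ℝ) < (m : ℝ) - d - 1 := by
    have : ((d + 1 : ℕ) : ℝ) < m := by exact_mod_cast hdm
    push_cast at this
    linarith
  have hmeas : Measurable fun s : Option (Fin d) × (Fin q × Fin m) → ℝ => ENNReal.ofReal
      ((∑ k, w k * leastSquaresEstimator m d (blockMatrix s k) (blockVector s k) j) ^ 2) := by
    refine ((Finset.measurable_fun_sum _ fun k _ => Measurable.const_mul ?_ _).pow_const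
      2).ennreal_ofReal
    exact (measurable_pi_apply j).comp
      (measurable_estimate_block (isMeasurable_leastSquaresEstimator m d) k)
  have hdiag : ∀ k, Measurable fun G : Fin d × (Fin q × Fin m) → ℝ =>
      ((canonicalBlock G k)ᵀ * canonicalBlock G k)⁻¹ j j := fun k =>
    (measurable_inv_mul_transpose j j).comp (measurePreserving_columns 0 k).measurable
  have hjoin := measurePreserving_joinArray (Fin d) (Fin q × Fin m) (m : ℝ≥0)⁻¹
  have hmeas' := hmeas.comp hjoin.measurable
  simp only [Function.comp_def] at hmeas'
  rw [← hjoin.lintegral_comp hmeas, lintegral_prod _ hmeas'.aemeasurable]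
  have hin : ∀ G : Fin d × (Fin q × Fin m) → ℝ,
      ∫⁻ ξ, ENNReal.ofReal ((∑ k, w k * leastSquaresEstimator m d (blockMatrix (joinArray (G, ξ)) k)
        (blockVector (joinArray (G, ξ)) k) j) ^ 2) ∂(gaussianVec (Fin q × Fin m) (m : ℝ≥0)⁻¹)
      = ∑ k, ENNReal.ofReal ((m : ℝ)⁻¹ * w k ^ 2) *
          ENNReal.ofReal (((canonicalBlock G k)ᵀ * canonicalBlock G k)⁻¹ j j) := by
    intro G
    set N : Fin q → Matrix (Fin d) (Fin m) ℝ := fun k =>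
      ((canonicalBlock G k)ᵀ * canonicalBlock G k)⁻¹ * (canonicalBlock G k)ᵀ
    set c : Fin q × Fin m → ℝ := fun p => w p.1 * N p.1 j p.2
    have h1 : ∀ ξ : Fin q × Fin m → ℝ,
        ∑ k, w k * leastSquaresEstimator m d (blockMatrix (joinArray (G, ξ)) k)
          (blockVector (joinArray (G, ξ)) k) j = ξ ⬝ᵥ c := by
      intro ξ
      rw [dotProduct, Fintype.sum_prod_type]
      refine Finset.sum_congr rfl fun k _ => ?_
      rw [blockMatrix_joinArray, blockVector_joinArray, leastSquaresEstimator, mulVec_mulVec,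
        mulVec, dotProduct, Finset.mul_sum]
      exact Finset.sum_congr rfl fun i _ => by simp only [c, N]; ring
    have h2 : ((m : ℝ)⁻¹) * (c ⬝ᵥ c)
        = ∑ k, ((m : ℝ)⁻¹ * w k ^ 2) *
          ((canonicalBlock G k)ᵀ * canonicalBlock G k)⁻¹ j j := by
      rw [dotProduct, Fintype.sum_prod_type, Finset.mul_sum]
      refine Finset.sum_congr rfl fun k _ => ?_
      rw [← sum_sq_pseudoinverse, mul_assoc]
      simp only [Finset.mul_sum]
      refine Finset.sum_congr rfl fun i _ => ?_
      change _ * (w k * N k j i * (w k * N k j i)) = _ * (w k ^ 2 * N k j i ^ 2)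
      ring
    have hnn : ∀ k, 0 ≤ ((canonicalBlock G k)ᵀ * canonicalBlock G k)⁻¹ j j := fun k => by
      rw [← sum_sq_pseudoinverse]
      exact Finset.sum_nonneg fun i _ => sq_nonneg _
    simp_rw [h1]
    rw [lintegral_sq_dotProduct_gaussianVec, NNReal.coe_inv, NNReal.coe_natCast, h2,
      ENNReal.ofReal_sum_of_nonneg fun k _ => mul_nonneg (by positivity) (hnn k)]
    exact Finset.sum_congr rfl fun k _ => ENNReal.ofReal_mul (by positivity)
  rw [lintegral_congr hin, lintegral_finsetSum _ fun k _ =>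
    ((hdiag k).ennreal_ofReal).const_mul _]
  have hk : ∀ k, ∫⁻ G, ENNReal.ofReal ((m : ℝ)⁻¹ * w k ^ 2) *
      ENNReal.ofReal (((canonicalBlock G k)ᵀ * canonicalBlock G k)⁻¹ j j)
        ∂(gaussianVec (Fin d × (Fin q × Fin m)) (m : ℝ≥0)⁻¹)
      = ENNReal.ofReal (w k ^ 2 / ((m : ℝ) - d - 1)) := by
    intro k
    have h3 := (measurePreserving_columns (d := d) (m := m) (m : ℝ≥0)⁻¹ k).lintegral_comp
      (measurable_inv_mul_transpose (ι := Fin m) j j).ennreal_ofReal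
    rw [lintegral_inv_mul_transpose_diag hdm hv] at h3
    rw [lintegral_const_mul _ (hdiag k).ennreal_ofReal]
    refine (congrArg _ h3).trans ?_
    rw [← ENNReal.ofReal_mul (by positivity), NNReal.coe_inv, NNReal.coe_natCast]
    congr 1
    field_simp
  rw [Finset.sum_congr rfl fun k _ => hk k, ← ENNReal.ofReal_sum_of_nonneg fun k _ => by positivity,
    Finset.sum_div]

/-! ### Unbiasedness and the error of averaged sketched least squares -/

lemma memLp_two_of_lintegral_sq_ne_top {X : Type*} [MeasurableSpace X] {μ : Measure X}
    {f : X → ℝ} (hf : Measurable f) (h : ∫⁻ x, ENNReal.ofReal (f x ^ 2) ∂μ ≠ ⊤) :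
    MemLp f 2 μ := by
  rw [memLp_two_iff_integrable_sq hf.aestronglyMeasurable]
  refine ⟨(hf.pow_const 2).aestronglyMeasurable, ?_⟩
  rw [hasFiniteIntegral_iff_ofReal (ae_of_all _ fun x => sq_nonneg _)]
  exact lt_top_iff_ne_top.2 h

lemma lintegral_ofReal_dotProduct_self {X : Type*} [MeasurableSpace X] {μ : Measure X} {d : ℕ}
    {f : X → Fin d → ℝ} (hf : Measurable f) :
    ∫⁻ x, ENNReal.ofReal (f x ⬝ᵥ f x) ∂μ = ∑ j, ∫⁻ x, ENNReal.ofReal (f x j ^ 2) ∂μ := by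
  have hm : ∀ j, Measurable fun x => ENNReal.ofReal (f x j ^ 2) := fun j =>
    (((measurable_pi_apply j).comp hf).pow_const 2).ennreal_ofReal
  rw [← lintegral_finsetSum _ fun j _ => hm j]
  refine lintegral_congr fun x => ?_
  rw [← ENNReal.ofReal_sum_of_nonneg fun j _ => sq_nonneg _]
  simp only [dotProduct, sq]

/-- The least squares error of block `k` of a canonical array. -/
noncomputable def canonicalError {q m d : ℕ} (k : Fin q)
    (s : Option (Fin d) × (Fin q × Fin m) → ℝ) : Fin d → ℝ :=
  leastSquaresEstimator m d (blockMatrix s k) (blockVector s k)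

lemma measurable_canonicalError {q m d : ℕ} (k : Fin q) :
    Measurable (canonicalError k : (Option (Fin d) × (Fin q × Fin m) → ℝ) → Fin d → ℝ) :=
  measurable_estimate_block (isMeasurable_leastSquaresEstimator m d) k

lemma integrable_canonicalError {q m d : ℕ} (hdm : d + 1 < m) (k : Fin q) :
    Integrable (canonicalError k)
      (gaussianVec (Option (Fin d) × (Fin q × Fin m)) (m : ℝ≥0)⁻¹) := by
  refine Integrable.of_eval fun j => ?_
  have h := lintegral_sq_sum_leastSquaresEstimator hdm (Pi.single k (1 : ℝ)) j
  simp only [Pi.single_apply, ite_mul, one_mul, zero_mul, Finset.sum_ite_eq', Finset.mem_univ,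
    if_true] at h
  refine (memLp_two_of_lintegral_sq_ne_top
    ((measurable_pi_apply j).comp (measurable_canonicalError k)) ?_).integrable one_le_two
  refine ne_of_eq_of_ne h ENNReal.ofReal_ne_top

/-- The canonical error has mean zero as it is odd in the noise. -/
lemma integral_canonicalError {q m d : ℕ} (v : ℝ≥0) (k : Fin q) :
    ∫ s, canonicalError k s ∂(gaussianVec (Option (Fin d) × (Fin q × Fin m)) v) = 0 := by
  set ε : Option (Fin d) × (Fin q × Fin m) → ℝ := fun c => c.1.elim (-1) fun _ => 1 with hε
  have hmp := measurePreserving_vecMul_gaussianVec v (C := diagonal ε) (by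
    rw [diagonal_transpose, diagonal_mul_diagonal, ← diagonal_one]
    congr 1
    funext c
    rcases c with ⟨_ | j, i⟩ <;> simp [hε])
  have h1 : ∀ s : Option (Fin d) × (Fin q × Fin m) → ℝ,
      canonicalError k (s ᵥ* diagonal ε) = - canonicalError k s := by
    intro s
    have e1 : blockMatrix (s ᵥ* diagonal ε) k = blockMatrix s k := by
      ext i j
      simp [blockMatrix, vecMul_diagonal, hε]
    have e2 : blockVector (s ᵥ* diagonal ε) k = - blockVector s k := by
      ext i
      simp [blockVector, vecMul_diagonal, hε]
    rw [canonicalError, e1, e2, leastSquaresEstimator, mulVec_neg, mulVec_neg]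
    rfl
  have h2 : ∫ s, canonicalError k (s ᵥ* diagonal ε)
      ∂(gaussianVec (Option (Fin d) × (Fin q × Fin m)) v)
      = ∫ s, canonicalError k s ∂(gaussianVec (Option (Fin d) × (Fin q × Fin m)) v) := by
    rw [← integral_map hmp.measurable.aemeasurable
      (measurable_canonicalError k).aestronglyMeasurable, hmp.map_eq]
  simp_rw [h1, integral_neg] at h2
  exact self_eq_neg.1 h2.symm

/-- Almost surely, an estimator that solves the sketched least squares problem whenever its
solution is unique has the error `σ R⁻¹ e` with the canonical error `e`. -/
lemma ae_mulVec_estimate_sub {q m d : ℕ} (hdm : d ≤ m) (hm : 0 < m) {g : Estimator m d}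
    (hg : ∀ M y, (Mᵀ * M).det ≠ 0 → g M y = leastSquaresEstimator m d M y)
    {R : Matrix (Fin d) (Fin d) ℝ} (hR : IsUnit R) (x : Fin d → ℝ) (σ : ℝ) (k : Fin q) :
    ∀ᵐ s ∂(gaussianVec (Option (Fin d) × (Fin q × Fin m)) (m : ℝ≥0)⁻¹),
      R *ᵥ (g (blockMatrix (s ᵥ* blockDiagonal fun _ => augmentRoot R x σ) k)
        (blockVector (s ᵥ* blockDiagonal fun _ => augmentRoot R x σ) k) - x)
        = σ • canonicalError k s := by
  have hv : (m : ℝ≥0)⁻¹ ≠ 0 := inv_ne_zero (by exact_mod_cast hm.ne')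
  filter_upwards [ae_det_blockMatrix_ne_zero hdm hv k] with s hs
  rw [blockMatrix_augmentRoot, blockVector_augmentRoot, hg,
    mulVec_leastSquaresEstimator_sub hs hR]
  · rfl
  · have hRd := ((isUnit_iff_isUnit_det _).1 hR).ne_zero
    rw [transpose_mul, show Rᵀ * (blockMatrix s k)ᵀ * (blockMatrix s k * R)
      = Rᵀ * ((blockMatrix s k)ᵀ * blockMatrix s k) * R by
        simp only [Matrix.mul_assoc], det_mul, det_mul, det_transpose]
    exact mul_ne_zero (mul_ne_zero hRd hs) hRd

section

variable {Ω : Type*} [MeasurableSpace Ω] {P : Measure Ω} {q m n d : ℕ}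
  {S : Fin q → Ω → Matrix (Fin m) (Fin n) ℝ}

lemma estimate_eq_block {Ω : Type*} (S : Fin q → Ω → Matrix (Fin m) (Fin n) ℝ) (g : Estimator m d)
    (A : Fin q → Matrix (Fin n) (Fin d) ℝ) (b : Fin q → Fin n → ℝ) (k : Fin q) (ω : Ω) :
    estimate g (A k) (b k) (S k ω)
      = g (blockMatrix (sketchEntries S ω ᵥ*
          blockDiagonal fun i : Fin q × Fin m => augment (A i.1) (b i.1)) k)
        (blockVector (sketchEntries S ω ᵥ*
          blockDiagonal fun i : Fin q × Fin m => augment (A i.1) (b i.1)) k) := by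
  rw [blockMatrix_sketchEntries, blockVector_sketchEntries, estimate]

lemma integrable_and_integral_comp_map {Z : Ω → (Option (Fin d) × (Fin q × Fin m) → ℝ)}
    {γ : Measure (Option (Fin d) × (Fin q × Fin m) → ℝ)}
    {T : (Option (Fin d) × (Fin q × Fin m) → ℝ) → (Option (Fin d) × (Fin q × Fin m) → ℝ)}
    (hZ : AEMeasurable Z P) (hT : Measurable T) (h : P.map Z = γ.map T)
    {E : Type*} [NormedAddCommGroup E] [NormedSpace ℝ E] [MeasurableSpace E] [BorelSpace E]
    [SecondCountableTopology E] {f : (Option (Fin d) × (Fin q × Fin m) → ℝ) → E}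
    (hf : Measurable f) :
    (Integrable (fun ω => f (Z ω)) P ↔ Integrable (fun s => f (T s)) γ) ∧
      ∫ ω, f (Z ω) ∂P = ∫ s, f (T s) ∂γ := by
  have h1 := integrable_map_measure (μ := P) hf.aestronglyMeasurable hZ
  have h2 := integrable_map_measure (μ := γ) hf.aestronglyMeasurable hT.aemeasurable
  rw [h] at h1
  refine ⟨h1.symm.trans h2, ?_⟩
  rw [← integral_map hZ hf.aestronglyMeasurable, h,
    integral_map hT.aemeasurable hf.aestronglyMeasurable]

lemma IsGaussianSketch.aemeasurable_vecMul (hS : IsGaussianSketch P S) {γ : Type*}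
    (C : Matrix (Fin n × (Fin q × Fin m)) γ ℝ) :
    AEMeasurable (fun ω => sketchEntries S ω ᵥ* C) P :=
  (measurable_vecMul_const C).comp_aemeasurable hS.aemeasurable_sketchEntries

variable [IsProbabilityMeasure P]

/-- Sketched least squares is unbiased. -/
theorem IsGaussianSketch.isUnbiased (hS : IsGaussianSketch P S) (hdm : d + 1 < m)
    {g : Estimator m d} (hgm : g.IsMeasurable)
    (hg : ∀ M y, (Mᵀ * M).det ≠ 0 → g M y = leastSquaresEstimator m d M y) (k : Fin q) :
    IsUnbiased P (S k) g := by
  intro A b x hA hx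
  obtain ⟨R, hRu, hR⟩ := exists_transpose_mul_self_of_posDef (posDef_transpose_mul_self_of_rank hA)
  have hσ : (√(lsCost A b x)) ^ 2 = lsCost A b x := Real.sq_sqrt (lsCost_nonneg A b x)
  set σ := √(lsCost A b x)
  have hlaw := hS.map_vecMul_blockDiagonal (B := fun _ => augment A b)
    (R := fun _ => augmentRoot R x σ) fun _ => augment_gram_eq hx hR hσ
  have hiff := integrable_and_integral_comp_map (hS.aemeasurable_vecMul _)
    (measurable_vecMul_const _) hlaw (measurable_estimate_block hgm k)
  have hest : ∀ ω, estimate g A b (S k ω) = _ := fun ω =>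
    estimate_eq_block S g (fun _ => A) (fun _ => b) k ω
  simp_rw [hest]
  have hae : (fun s : Option (Fin d) × (Fin q × Fin m) → ℝ =>
      g (blockMatrix (s ᵥ* blockDiagonal fun _ => augmentRoot R x σ) k)
        (blockVector (s ᵥ* blockDiagonal fun _ => augmentRoot R x σ) k))
      =ᵐ[gaussianVec _ (m : ℝ≥0)⁻¹] fun s => R⁻¹ *ᵥ (σ • canonicalError k s) + x := by
    filter_upwards [ae_mulVec_estimate_sub (by omega) (by omega) hg hRu x σ k] with s hs
    rw [← hs, mulVec_mulVec, nonsing_inv_mul _ ((isUnit_iff_isUnit_det _).1 hRu), one_mulVec,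
      sub_add_cancel]
  set L : (Fin d → ℝ) →L[ℝ] (Fin d → ℝ) := LinearMap.toContinuousLinearMap (toLin' R⁻¹)
  have hL : ∀ y, R⁻¹ *ᵥ y = L y := fun y => rfl
  have hi : Integrable (fun s => R⁻¹ *ᵥ (σ • canonicalError k s))
      (gaussianVec (Option (Fin d) × (Fin q × Fin m)) (m : ℝ≥0)⁻¹) := by
    simp_rw [hL]
    exact L.integrable_comp ((integrable_canonicalError hdm k).smul σ)
  refine ⟨hiff.1.2 ((integrable_congr hae).2 (hi.add (integrable_const x))), ?_⟩
  refine hiff.2.trans ?_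
  rw [integral_congr_ae hae, integral_add hi (integrable_const x)]
  simp_rw [hL]
  have h0 := L.integral_comp_comm ((integrable_canonicalError hdm k).smul σ)
  simp only [Pi.smul_apply] at h0
  rw [h0, integral_smul, integral_canonicalError, smul_zero, map_zero, zero_add, integral_const]
  simp

/-- The average of the canonical errors has the second moment `σ² d / (q (m - d - 1))`. -/
lemma lintegral_averaged_canonicalError (hq : 0 < q) (hdm : d + 1 < m) (σ : ℝ) :
    ∫⁻ s, ENNReal.ofReal ((σ • (q : ℝ)⁻¹ • ∑ k : Fin q, canonicalError k s) ⬝ᵥ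
        (σ • (q : ℝ)⁻¹ • ∑ k : Fin q, canonicalError k s))
      ∂(gaussianVec (Option (Fin d) × (Fin q × Fin m)) (m : ℝ≥0)⁻¹)
      = ENNReal.ofReal (σ ^ 2 / q * (d / ((m : ℝ) - d - 1))) := by
  have hq' : (q : ℝ) ≠ 0 := by exact_mod_cast hq.ne'
  have hpos : (0 : ℝ) < (m : ℝ) - d - 1 := by
    have : ((d + 1 : ℕ) : ℝ) < m := by exact_mod_cast hdm
    push_cast at this
    linarith
  have hmeas : Measurable fun s : Option (Fin d) × (Fin q × Fin m) → ℝ =>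
      σ • (q : ℝ)⁻¹ • ∑ k : Fin q, canonicalError k s := by
    have h1 : Measurable fun s : Option (Fin d) × (Fin q × Fin m) → ℝ =>
        ∑ k : Fin q, canonicalError k s :=
      Finset.measurable_fun_sum _ fun k _ => measurable_canonicalError k
    exact (h1.const_smul (q : ℝ)⁻¹).const_smul σ
  rw [lintegral_ofReal_dotProduct_self hmeas]
  have h1 : ∀ j : Fin d, ∫⁻ s, ENNReal.ofReal
      ((σ • (q : ℝ)⁻¹ • ∑ k : Fin q, canonicalError k s) j ^ 2)
      ∂(gaussianVec (Option (Fin d) × (Fin q × Fin m)) (m : ℝ≥0)⁻¹)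
      = ENNReal.ofReal (σ ^ 2 / q / ((m : ℝ) - d - 1)) := by
    intro j
    have h2 := lintegral_sq_sum_leastSquaresEstimator hdm (fun _ : Fin q => σ * (q : ℝ)⁻¹) j
    refine Eq.trans (lintegral_congr fun s => ?_) (h2.trans ?_)
    · congr 2
      simp only [Pi.smul_apply, Finset.sum_apply, smul_eq_mul, Finset.mul_sum, canonicalError,
        mul_assoc]
    · congr 1
      rw [Finset.sum_const, Finset.card_univ, Fintype.card_fin, nsmul_eq_mul]
      field_simp
  rw [Finset.sum_congr rfl fun j _ => h1 j, ← ENNReal.ofReal_sum_of_nonneg fun j _ => by positivity,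
    Finset.sum_const, Finset.card_univ, Fintype.card_fin, nsmul_eq_mul]
  congr 1
  ring

lemma ae_mulVec_arrayEstimate_sub (hq : 0 < q) (hdm : d ≤ m) (hm : 0 < m)
    {g : Fin q → Estimator m d}
    (hg : ∀ k M y, (Mᵀ * M).det ≠ 0 → g k M y = leastSquaresEstimator m d M y)
    {R : Matrix (Fin d) (Fin d) ℝ} (hR : IsUnit R) (x : Fin d → ℝ) (σ : ℝ) :
    ∀ᵐ s ∂(gaussianVec (Option (Fin d) × (Fin q × Fin m)) (m : ℝ≥0)⁻¹),
      R *ᵥ (arrayEstimate g (s ᵥ* blockDiagonal fun _ => augmentRoot R x σ) - x)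
        = σ • (q : ℝ)⁻¹ • ∑ k, canonicalError k s := by
  have hq' : (q : ℝ) ≠ 0 := by exact_mod_cast hq.ne'
  filter_upwards [ae_all_iff.2 fun k =>
    ae_mulVec_estimate_sub hdm hm (hg k) hR x σ k] with s hs
  have hx : x = (q : ℝ)⁻¹ • ∑ _k : Fin q, x := by
    rw [Finset.sum_const, Finset.card_univ, Fintype.card_fin, ← Nat.cast_smul_eq_nsmul ℝ, smul_smul,
      inv_mul_cancel₀ hq', one_smul]
  rw [arrayEstimate]
  conv_lhs => enter [2, 2]; rw [hx]
  rw [← smul_sub, ← Finset.sum_sub_distrib, mulVec_smul, mulVec_sum,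
    Finset.sum_congr rfl fun k _ => hs k, ← Finset.smul_sum, smul_comm]

/-- Averaged sketched least squares attains the lower bound for unbiased estimators. -/
theorem IsGaussianSketch.expectedError_leastSquares (hS : IsGaussianSketch P S) (hq : 0 < q)
    (hdm : d + 1 < m) {g : Fin q → Estimator m d} (hgm : ∀ k, (g k).IsMeasurable)
    (hg : ∀ k M y, (Mᵀ * M).det ≠ 0 → g k M y = leastSquaresEstimator m d M y)
    {A : Matrix (Fin n) (Fin d) ℝ} {b : Fin n → ℝ} {x : Fin d → ℝ} (hA : A.rank = d)
    (hx : IsLeastSquaresSol A b x) :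
    expectedError P S g A b x
      = ENNReal.ofReal (lsCost A b x / q * (d / ((m : ℝ) - d - 1))) := by
  obtain ⟨R, hRu, hR⟩ := exists_transpose_mul_self_of_posDef (posDef_transpose_mul_self_of_rank hA)
  have hσ : (√(lsCost A b x)) ^ 2 = lsCost A b x := Real.sq_sqrt (lsCost_nonneg A b x)
  rw [hS.expectedError_eq hgm hx hR hσ, lintegral_congr_ae
    ((ae_mulVec_arrayEstimate_sub hq (by omega) (by omega) hg hRu x _).mono fun s hs => by rw [hs]),
    lintegral_averaged_canonicalError hq hdm, hσ]

end

/-! ### The lower bound for unbiased estimators -/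

/-- Pythagoras: `∫ v² ≤ ∫ u²` if `u - v` is orthogonal to `v`. -/
lemma lintegral_sq_le_of_integral_eq_zero {X : Type*} [MeasurableSpace X] {μ : Measure X}
    {u v : X → ℝ} (hu : MemLp u 2 μ) (hv : MemLp v 2 μ) (h : ∫ x, (u x - v x) * v x ∂μ = 0) :
    ∫⁻ x, ENNReal.ofReal (v x ^ 2) ∂μ ≤ ∫⁻ x, ENNReal.ofReal (u x ^ 2) ∂μ := by
  have hu2 := hu.integrable_sq
  have hv2 := hv.integrable_sq
  have huv : Integrable (fun x => (u x - v x) * v x) μ := (hu.sub hv).integrable_mul hv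
  rw [← ofReal_integral_eq_lintegral_ofReal hu2 (ae_of_all _ fun x => sq_nonneg _),
    ← ofReal_integral_eq_lintegral_ofReal hv2 (ae_of_all _ fun x => sq_nonneg _)]
  refine ENNReal.ofReal_le_ofReal ?_
  have h1 : ∫ x, (v x ^ 2 + 2 * ((u x - v x) * v x)) ∂μ ≤ ∫ x, u x ^ 2 ∂μ :=
    integral_mono (hv2.add (huv.const_mul 2)) hu2 fun x => by
      show v x ^ 2 + 2 * ((u x - v x) * v x) ≤ u x ^ 2
      nlinarith [sq_nonneg (u x - v x)]
  rwa [integral_add hv2 (huv.const_mul 2), integral_const_mul, h, mul_zero, add_zero] at h1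

lemma blockGram_fst {q m : ℕ} {κ : Type*} (s : κ × (Fin q × Fin m) → ℝ) (k : Fin q) (a b : κ) :
    blockGram Prod.fst s k a b = ∑ i, s (a, (k, i)) * s (b, (k, i)) := by
  rw [blockGram, Fintype.sum_prod_type, Finset.sum_eq_single k]
  · simp
  · intro k' _ hk
    simp [hk]
  · simp

/-- The canonical error of a block as a function of its Gram matrix. -/
lemma canonicalError_eq_blockGram {q m d : ℕ} (k : Fin q)
    (s : Option (Fin d) × (Fin q × Fin m) → ℝ) :
    canonicalError k s = (Matrix.of fun a b => blockGram Prod.fst s k (some a) (some b))⁻¹ *ᵥ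
      fun a => blockGram Prod.fst s k (some a) none := by
  simp only [blockGram_fst]
  rfl

lemma isUnit_augmentRoot {d : ℕ} {R : Matrix (Fin d) (Fin d) ℝ} (hR : IsUnit R) (x : Fin d → ℝ)
    {σ : ℝ} (hσ : σ ≠ 0) : IsUnit (augmentRoot R x σ) := by
  rw [← mulVec_injective_iff_isUnit] at hR ⊢
  refine (injective_iff_map_eq_zero (augmentRoot R x σ).mulVecLin).2 fun y hy => ?_
  rw [mulVecLin_apply] at hy
  have h0 : y none = 0 := by
    have := congrFun hy none
    simpa [mulVec, dotProduct, Fintype.sum_option, augmentRoot, hσ] using this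
  have h1 : R *ᵥ (fun j => y (some j)) = R *ᵥ 0 := by
    ext i
    have := congrFun hy (some i)
    simp only [mulVec, dotProduct, Fintype.sum_option, augmentRoot, of_apply, Option.elim, h0,
      mul_zero, zero_add] at this
    simpa [mulVec, dotProduct] using this
  have h2 := hR h1
  ext c
  rcases c with _ | j
  · exact h0
  · exact congrFun h2 j

lemma posDef_transpose_mul_self_of_isUnit {κ : Type*} [Fintype κ] [DecidableEq κ]
    {N : Matrix κ κ ℝ} (hN : IsUnit N) : (Nᵀ * N).PosDef := by
  have := PosDef.conjTranspose_mul_self N (mulVec_injective_iff_isUnit.2 hN)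
  rwa [conjTranspose_eq_transpose_of_trivial] at this

section

variable {Ω : Type*} [MeasurableSpace Ω] {P : Measure Ω} [IsProbabilityMeasure P] {q m n d : ℕ}
  {S : Fin q → Ω → Matrix (Fin m) (Fin n) ℝ}

/-- The difference of the averages of two families of unbiased estimators has mean zero whenever
the sketched data have nondegenerate covariances, which may differ from sketch to sketch. -/
lemma IsGaussianSketch.integral_arrayEstimate_sub_eq_zero (hS : IsGaussianSketch P S)
    {g g' : Fin q → Estimator m d} (hgm : ∀ k, (g k).IsMeasurable)
    (hgm' : ∀ k, (g' k).IsMeasurable) (hg : ∀ k, IsUnbiased P (S k) (g k))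
    (hg' : ∀ k, IsUnbiased P (S k) (g' k)) {B : Matrix (Fin n) (Option (Fin d)) ℝ}
    {Q : Matrix (Option (Fin d)) (Option (Fin d)) ℝ} (hQ : IsUnit Q) (hB : Bᵀ * B = Qᵀ * Q)
    {N : Fin q → Matrix (Option (Fin d)) (Option (Fin d)) ℝ} (hN : ∀ k, IsUnit (N k)) :
    Integrable (fun s => arrayEstimate g (s ᵥ* blockDiagonal fun i : Fin q × Fin m => N i.1)
        - arrayEstimate g' (s ᵥ* blockDiagonal fun i : Fin q × Fin m => N i.1))
      (gaussianVec (Option (Fin d) × (Fin q × Fin m)) (m : ℝ≥0)⁻¹) ∧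
    ∫ s, (arrayEstimate g (s ᵥ* blockDiagonal fun i : Fin q × Fin m => N i.1)
        - arrayEstimate g' (s ᵥ* blockDiagonal fun i : Fin q × Fin m => N i.1))
      ∂(gaussianVec (Option (Fin d) × (Fin q × Fin m)) (m : ℝ≥0)⁻¹) = 0 := by
  -- problems whose sketched data have the covariances `Nₖᵀ Nₖ`
  set D : Fin q → Matrix (Fin n) (Option (Fin d)) ℝ := fun k => B * (Q⁻¹ * N k) with hD
  set A : Fin q → Matrix (Fin n) (Fin d) ℝ := fun k => (D k).submatrix id some
  set b : Fin q → Fin n → ℝ := fun k i => D k i none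
  have hDA : ∀ k, augment (A k) (b k) = D k := fun k => by
    ext i c
    rcases c with _ | j <;> rfl
  have hgram : ∀ k, (D k)ᵀ * D k = (N k)ᵀ * N k := fun k => by
    have hQd := (isUnit_iff_isUnit_det _).1 hQ
    have h1 : (D k)ᵀ * D k = (Q⁻¹ * N k)ᵀ * (Bᵀ * B) * (Q⁻¹ * N k) := by
      simp only [hD, transpose_mul, Matrix.mul_assoc]
    rw [h1, hB, ← Matrix.mul_assoc _ Qᵀ, ← transpose_mul, ← Matrix.mul_assoc Q,
      mul_nonsing_inv _ hQd, Matrix.one_mul, Matrix.mul_assoc, ← Matrix.mul_assoc Q,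
      mul_nonsing_inv _ hQd, Matrix.one_mul]
  have hdet : ∀ k, ((A k)ᵀ * A k).det ≠ 0 := fun k => by
    have h1 := (posDef_transpose_mul_self_of_isUnit (hN k)).submatrix
      (Option.some_injective (Fin d))
    rw [← hgram] at h1
    exact h1.det_pos.ne'
  have hsol : ∀ k, IsLeastSquaresSol (A k) (b k) (leastSquaresEstimator n d (A k) (b k)) :=
    fun k => (isLeastSquaresSol_iff_eq (hdet k)).2 rfl
  have hrank : ∀ k, (A k).rank = d := fun k => rank_eq_of_det_ne_zero (hdet k)
  have hlaw := hS.map_vecMul_blockDiagonal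
    (B := fun i : Fin q × Fin m => augment (A i.1) (b i.1)) (R := fun i => N i.1)
    fun i => by rw [hDA, hgram]
  have hm := (measurable_arrayEstimate hgm).sub (measurable_arrayEstimate hgm')
  have hiff := integrable_and_integral_comp_map (hS.aemeasurable_vecMul _)
    (measurable_vecMul_const _) hlaw hm
  simp only [Pi.sub_apply] at hiff
  have hest : ∀ (g : Fin q → Estimator m d) ω, arrayEstimate g (sketchEntries S ω ᵥ*
      blockDiagonal fun i : Fin q × Fin m => augment (A i.1) (b i.1))
      = (q : ℝ)⁻¹ • ∑ k, estimate (g k) (A k) (b k) (S k ω) := fun g ω => by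
    rw [arrayEstimate]
    congr 1
    exact Finset.sum_congr rfl fun k _ => (estimate_eq_block S (g k) A b k ω).symm
  simp_rw [hest] at hiff
  have hi : ∀ {g : Fin q → Estimator m d}, (∀ k, IsUnbiased P (S k) (g k)) →
      Integrable (fun ω => (q : ℝ)⁻¹ • ∑ k, estimate (g k) (A k) (b k) (S k ω)) P := fun hg =>
    (integrable_finsetSum _ fun k _ => (hg k _ _ _ (hrank k) (hsol k)).1).smul (q : ℝ)⁻¹
  have h0 : ∀ {g : Fin q → Estimator m d}, (∀ k, IsUnbiased P (S k) (g k)) →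
      ∫ ω, (q : ℝ)⁻¹ • ∑ k, estimate (g k) (A k) (b k) (S k ω) ∂P
        = (q : ℝ)⁻¹ • ∑ k, leastSquaresEstimator n d (A k) (b k) := fun hg => by
    rw [integral_smul, integral_finsetSum _ fun k _ => (hg k _ _ _ (hrank k) (hsol k)).1]
    congr 1
    exact Finset.sum_congr rfl fun k _ => (hg k _ _ _ (hrank k) (hsol k)).2
  refine ⟨hiff.1.1 ((hi hg).sub (hi hg')), hiff.2.symm.trans ?_⟩
  rw [integral_sub (hi hg) (hi hg'), h0 hg, h0 hg', sub_self]

/-- The lower bound for averages of unbiased estimators: the least squares errors are functions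
of a complete statistic, so the other unbiased estimators deviate from them orthogonally. -/
theorem IsGaussianSketch.le_expectedError_of_isUnbiased (hS : IsGaussianSketch P S) (hq : 0 < q)
    (hdm : d + 1 < m) {g : Fin q → Estimator m d} (hgm : ∀ k, (g k).IsMeasurable)
    (hg : ∀ k, IsUnbiased P (S k) (g k))
    {A : Matrix (Fin n) (Fin d) ℝ} {b : Fin n → ℝ} {x : Fin d → ℝ} (hA : A.rank = d)
    (hx : IsLeastSquaresSol A b x) :
    ENNReal.ofReal (lsCost A b x / q * (d / ((m : ℝ) - d - 1))) ≤ expectedError P S g A b x := by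
  have hv : (m : ℝ≥0)⁻¹ ≠ 0 := inv_ne_zero (by
    have : m ≠ 0 := by omega
    exact_mod_cast this)
  rcases (lsCost_nonneg A b x).eq_or_lt with hc | hc
  · simp [← hc]
  obtain ⟨R, hRu, hR⟩ := exists_transpose_mul_self_of_posDef (posDef_transpose_mul_self_of_rank hA)
  have hσ : (√(lsCost A b x)) ^ 2 = lsCost A b x := Real.sq_sqrt hc.le
  have hσ0 : √(lsCost A b x) ≠ 0 := (Real.sqrt_pos.2 hc).ne'
  set σ := √(lsCost A b x)
  set γ := gaussianVec (Option (Fin d) × (Fin q × Fin m)) (m : ℝ≥0)⁻¹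
  set Q := augmentRoot R x σ
  have hQ : IsUnit Q := isUnit_augmentRoot hRu x hσ0
  set T : (Option (Fin d) × (Fin q × Fin m) → ℝ) → (Option (Fin d) × (Fin q × Fin m) → ℝ) :=
    fun s => s ᵥ* blockDiagonal fun _ => Q
  have hT : Measurable T := measurable_vecMul_const _
  set l : Fin q → Estimator m d := fun _ => leastSquaresEstimator m d
  have hlm : ∀ k, (l k).IsMeasurable := fun _ => isMeasurable_leastSquaresEstimator m d
  have hl : ∀ k, IsUnbiased P (S k) (l k) :=
    fun k => hS.isUnbiased hdm (hlm k) (fun _ _ _ => rfl) k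
  set u : (Option (Fin d) × (Fin q × Fin m) → ℝ) → Fin d → ℝ :=
    fun s => R *ᵥ (arrayEstimate g (T s) - x)
  set w : (Option (Fin d) × (Fin q × Fin m) → ℝ) → Fin d → ℝ :=
    fun s => σ • (q : ℝ)⁻¹ • ∑ k : Fin q, canonicalError k s
  have hum : Measurable u := (measurable_mulVec_const R).comp
    (((measurable_arrayEstimate hgm).comp hT).sub_const x)
  have hwm : Measurable w := by
    have h1 : Measurable fun s : Option (Fin d) × (Fin q × Fin m) → ℝ =>
        ∑ k : Fin q, canonicalError k s :=
      Finset.measurable_fun_sum _ fun k _ => measurable_canonicalError k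
    exact (h1.const_smul (q : ℝ)⁻¹).const_smul σ
  rw [hS.expectedError_eq hgm hx hR hσ, ← hσ, ← lintegral_averaged_canonicalError hq hdm σ]
  change ∫⁻ s, ENNReal.ofReal (w s ⬝ᵥ w s) ∂γ ≤ ∫⁻ s, ENNReal.ofReal (u s ⬝ᵥ u s) ∂γ
  have hwfin : ∫⁻ s, ENNReal.ofReal (w s ⬝ᵥ w s) ∂γ ≠ ⊤ := by
    have := lintegral_averaged_canonicalError (d := d) hq hdm σ
    exact ne_of_eq_of_ne this ENNReal.ofReal_ne_top
  by_cases hufin : ∫⁻ s, ENNReal.ofReal (u s ⬝ᵥ u s) ∂γ = ⊤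
  · rw [hufin]; exact le_top
  rw [lintegral_ofReal_dotProduct_self hum] at hufin ⊢
  rw [lintegral_ofReal_dotProduct_self hwm] at hwfin ⊢
  refine Finset.sum_le_sum fun j _ => ?_
  have huj : MemLp (fun s => u s j) 2 γ := memLp_two_of_lintegral_sq_ne_top
    ((measurable_pi_apply j).comp hum) (ENNReal.sum_ne_top.1 hufin j (Finset.mem_univ j))
  have hwj : MemLp (fun s => w s j) 2 γ := memLp_two_of_lintegral_sq_ne_top
    ((measurable_pi_apply j).comp hwm) (ENNReal.sum_ne_top.1 hwfin j (Finset.mem_univ j))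
  refine lintegral_sq_le_of_integral_eq_zero huj hwj ?_
  -- the deviation from averaged least squares, which has mean zero under all the covariances
  set h : (Option (Fin d) × (Fin q × Fin m) → ℝ) → ℝ :=
    fun s => (R *ᵥ (arrayEstimate g (T s) - arrayEstimate l (T s))) j
  have hhm : Measurable h := (measurable_pi_apply j).comp ((measurable_mulVec_const R).comp
    (((measurable_arrayEstimate hgm).comp hT).sub ((measurable_arrayEstimate hlm).comp hT)))
  set ψ : (Fin q → Option (Fin d) → Option (Fin d) → ℝ) → ℝ := fun W =>
    σ * ((q : ℝ)⁻¹ * ∑ k, ((Matrix.of fun a b => W k (some a) (some b))⁻¹ *ᵥ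
      fun a => W k (some a) none) j)
  have hψ : Measurable ψ := by
    refine ((Finset.measurable_fun_sum _ fun k _ => ?_).const_mul _).const_mul _
    simp only [mulVec, dotProduct]
    refine Finset.measurable_fun_sum _ fun i _ => Measurable.mul ?_ (by fun_prop)
    have h1 : Measurable fun W : Fin q → Option (Fin d) → Option (Fin d) → ℝ =>
        (fun a b => W k (some a) (some b) : Fin d → Fin d → ℝ) := by fun_prop
    exact (measurable_matrix_inv_apply j i).comp h1
  have hψw : ∀ s, ψ (blockGram Prod.fst s) = w s j := fun s => by
    simp only [ψ, w, Pi.smul_apply, Finset.sum_apply, smul_eq_mul, canonicalError_eq_blockGram]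
  have hae : ∀ᵐ s ∂γ, (u s j - w s j) * w s j = h s * ψ (blockGram Prod.fst s) := by
    filter_upwards [ae_mulVec_arrayEstimate_sub hq (by omega) (by omega)
      (g := l) (fun _ _ _ _ => rfl) hRu x σ] with s hs
    have hw : w s = R *ᵥ (arrayEstimate l (T s) - x) := hs.symm
    rw [hψw]
    congr 1
    rw [hw]
    simp only [u, h, mulVec_sub, Pi.sub_apply]
    ring
  rw [integral_congr_ae hae]
  refine integral_mul_blockGram_eq_zero Prod.fst hv hhm (fun N hN => ?_) hψ
  have hTN : ∀ s, T (s ᵥ* blockDiagonal fun i : Fin q × Fin m => N i.1)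
      = s ᵥ* blockDiagonal fun i : Fin q × Fin m => N i.1 * Q := fun s => by
    simp only [T, vecMul_vecMul, ← blockDiagonal_mul]
  have hkey := hS.integral_arrayEstimate_sub_eq_zero hgm hlm hg hl hQ
    (augment_gram_eq hx hR hσ) (N := fun k => N k * Q) fun k => (hN k).mul hQ
  set L : (Fin d → ℝ) →L[ℝ] ℝ :=
    (ContinuousLinearMap.proj j).comp (LinearMap.toContinuousLinearMap (toLin' R))
  have hL : ∀ y, (R *ᵥ y) j = L y := fun y => rfl
  simp only [h, hTN, hL]
  refine ⟨L.integrable_comp hkey.1, ?_⟩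
  rw [L.integral_comp_comm hkey.1, hkey.2, map_zero]

end

/-! ### Gaussian priors and Bayes risk -/

lemma vecMul_reflection {α : Type*} [Fintype α] [DecidableEq α] (a x : α → ℝ) (r : ℝ) :
    x ᵥ* (1 - r • vecMulVec a a) = x - (r * (x ⬝ᵥ a)) • a := by
  rw [vecMul_sub, vecMul_one, vecMul_smul, vecMul_vecMulVec, smul_smul]

/-- If the data `x ᵥ* C` are uncorrelated with `x ⬝ᵥ a`, then no function of them estimates
`x ⬝ᵥ p` with a mean squared error below `v (a ⬝ᵥ p)² / (a ⬝ᵥ a)`: the reflection along `a`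
preserves the law and the data, but moves `x ⬝ᵥ p`. The bound stated here is the smaller quantity
`v (2 (a ⬝ᵥ p) - a ⬝ᵥ a)`, which is linear in the variance `a ⬝ᵥ a`. -/
lemma le_lintegral_sq_sub_gaussianVec {α γ : Type*} [Fintype α] (v : ℝ≥0)
    {C : Matrix α γ ℝ} {f : (γ → ℝ) → ℝ} (hf : Measurable f) {a : α → ℝ} (p : α → ℝ)
    (ha : a ᵥ* C = 0) :
    ENNReal.ofReal (v * (2 * (a ⬝ᵥ p) - a ⬝ᵥ a))
      ≤ ∫⁻ x, ENNReal.ofReal ((f (x ᵥ* C) - x ⬝ᵥ p) ^ 2) ∂(gaussianVec α v) := by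
  classical
  rcases (dotProduct_self_nonneg' a).eq_or_lt with h0 | h0
  · have : a = 0 := dotProduct_self_eq_zero.1 h0.symm
    simp [this]
  set u : (α → ℝ) → ℝ := fun x => f (x ᵥ* C) - x ⬝ᵥ p
  have hp : Measurable fun x : α → ℝ => x ⬝ᵥ p := by unfold dotProduct; fun_prop
  have hu : Measurable u := (hf.comp (measurable_vecMul_const C)).sub hp
  set r : ℝ := 2 / (a ⬝ᵥ a)
  set H : Matrix α α ℝ := 1 - r • vecMulVec a a
  have hH : Hᵀ * H = 1 := by
    have hT : Hᵀ = H := by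
      simp only [H, transpose_sub, transpose_one, transpose_smul, transpose_vecMulVec]
    refine Matrix.ext_iff_vecMul.2 fun x => ?_
    have hr : r * (a ⬝ᵥ a) = 2 := div_mul_cancel₀ _ h0.ne'
    rw [hT, ← vecMul_vecMul, vecMul_reflection, vecMul_reflection, sub_dotProduct, smul_dotProduct,
      smul_eq_mul, vecMul_one, show r * (x ⬝ᵥ a - r * (x ⬝ᵥ a) * (a ⬝ᵥ a)) = -(r * (x ⬝ᵥ a)) by
        linear_combination (-(r * (x ⬝ᵥ a))) * hr]
    simp
  have hHp := measurePreserving_vecMul_gaussianVec v hH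
  have h1 : ∀ x, u (x ᵥ* H) = u x + r * (x ⬝ᵥ a) * (a ⬝ᵥ p) := fun x => by
    simp only [u, H, vecMul_reflection, sub_vecMul, smul_vecMul, ha, smul_zero, sub_zero,
      sub_dotProduct, smul_dotProduct, smul_eq_mul]
    ring
  have h2 := hHp.lintegral_comp (f := fun x => ENNReal.ofReal (u x ^ 2)) (by fun_prop)
  have h3 : ∀ x, ENNReal.ofReal ((x ⬝ᵥ ((a ⬝ᵥ p / (a ⬝ᵥ a)) • a)) ^ 2) ≤ ENNReal.ofReal (1 / 2) *
      (ENNReal.ofReal (u x ^ 2) + ENNReal.ofReal (u (x ᵥ* H) ^ 2)) := fun x => by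
    rw [← ENNReal.ofReal_add (sq_nonneg _) (sq_nonneg _), ← ENNReal.ofReal_mul (by norm_num), h1]
    refine ENNReal.ofReal_le_ofReal ?_
    rw [dotProduct_smul, smul_eq_mul,
      show r * (x ⬝ᵥ a) * (a ⬝ᵥ p) = 2 * (a ⬝ᵥ p / (a ⬝ᵥ a) * (x ⬝ᵥ a)) by simp only [r]; ring]
    nlinarith [sq_nonneg (u x + a ⬝ᵥ p / (a ⬝ᵥ a) * (x ⬝ᵥ a))]
  have h4 := lintegral_mono (μ := gaussianVec α v) h3
  rw [lintegral_const_mul' _ _ ENNReal.ofReal_ne_top,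
    lintegral_add_left (by fun_prop), h2, ← two_mul,
    ← mul_assoc, show (2 : ℝ≥0∞) = ENNReal.ofReal 2 by simp,
    ← ENNReal.ofReal_mul (by norm_num), show (1 / 2 * 2 : ℝ) = 1 by norm_num, ENNReal.ofReal_one,
    one_mul, lintegral_sq_dotProduct_gaussianVec] at h4
  refine le_trans (ENNReal.ofReal_le_ofReal ?_) h4
  refine mul_le_mul_of_nonneg_left ?_ v.2
  rw [dotProduct_smul, smul_dotProduct, smul_eq_mul, smul_eq_mul]
  set c := a ⬝ᵥ p / (a ⬝ᵥ a)
  have : a ⬝ᵥ p = c * (a ⬝ᵥ a) := (div_mul_cancel₀ _ h0.ne').symm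
  rw [this]
  nlinarith [mul_nonneg h0.le (sq_nonneg (c - 1))]

lemma joinArray_vecMul_augmentRoot_add {q m d : ℕ} (R : Matrix (Fin d) (Fin d) ℝ)
    (x z : Fin d → ℝ) (σ : ℝ) (G : Fin d × (Fin q × Fin m) → ℝ) (ξ : Fin q × Fin m → ℝ) :
    joinArray (G, ξ) ᵥ* blockDiagonal (fun _ => augmentRoot R (x + z) σ)
      = joinArray (G, fun i => σ * ξ i + ∑ j, G (j, i) * (R *ᵥ z) j)
          ᵥ* blockDiagonal (fun _ => augmentRoot R x 1) := by
  ext ⟨c, i⟩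
  rw [vecMul_blockDiagonal_apply, vecMul_blockDiagonal_apply]
  rcases c with _ | c
  · simp only [vecMul, dotProduct, Fintype.sum_option, joinArray, augmentRoot, of_apply,
      Option.elim, mulVec_add, Pi.add_apply, mul_add, Finset.sum_add_distrib]
    ring
  · simp [vecMul, dotProduct, Fintype.sum_option, joinArray, augmentRoot]

lemma isLeastSquaresSol_add {n d : ℕ} {A : Matrix (Fin n) (Fin d) ℝ} {b : Fin n → ℝ}
    {x : Fin d → ℝ} (hx : IsLeastSquaresSol A b x) (z : Fin d → ℝ) :
    IsLeastSquaresSol A (b + A *ᵥ z) (x + z) := by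
  rw [isLeastSquaresSol_iff] at hx ⊢
  rwa [mulVec_add, add_sub_add_right_eq_sub]

lemma lsCost_add_add {n d : ℕ} (A : Matrix (Fin n) (Fin d) ℝ) (b : Fin n → ℝ) (x z : Fin d → ℝ) :
    lsCost A (b + A *ᵥ z) (x + z) = lsCost A b x := by
  rw [lsCost, lsCost, mulVec_add, add_sub_add_right_eq_sub]

/-- A lower bound for the error of an estimator of `θⱼ`, given the sketched matrices `G`, under a
Gaussian prior of scale `t` on `θ`. The bound is free of `G` apart from the last summand on the
right, which is ready to be averaged over `G`. -/
lemma le_lintegral_bayes_error {q m d : ℕ} (v : ℝ≥0) {σ t : ℝ} (hσ : σ ≠ 0) (ht : t ≠ 0) (l : ℝ)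
    (G : Fin d × (Fin q × Fin m) → ℝ) {f : (Fin q × Fin m → ℝ) → ℝ} (hf : Measurable f)
    (j : Fin d) :
    ENNReal.ofReal (v * (2 * l - l ^ 2 / t ^ 2)) ≤
      (∫⁻ ξ, ∫⁻ η, ENNReal.ofReal ((f (fun i => σ * ξ i + ∑ k, G (k, i) * (t * η k)) - t * η j) ^ 2)
        ∂(gaussianVec (Fin d) v) ∂(gaussianVec (Fin q × Fin m) v))
      + ENNReal.ofReal (v * (l ^ 2 / σ ^ 2)) * ∑ i, ENNReal.ofReal (G (j, i) ^ 2) := by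
  -- on vectors `(ξ, η)` with `θ = t η`, the matrix `C` yields the data, `a` is proportional to the
  -- `j`-th score and `p` yields `θⱼ`
  set C : Matrix ((Fin q × Fin m) ⊕ Fin d) (Fin q × Fin m) ℝ := Matrix.of fun c i =>
    c.elim (fun i' => if i' = i then σ else 0) fun k => t * G (k, i)
  set a : (Fin q × Fin m) ⊕ Fin d → ℝ := fun c =>
    c.elim (fun i => -(l / σ * G (j, i))) fun k => if k = j then l / t else 0
  set p : (Fin q × Fin m) ⊕ Fin d → ℝ := fun c =>
    c.elim (fun _ => 0) fun k => if k = j then t else 0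
  have ha : a ᵥ* C = 0 := by
    ext i
    simp only [vecMul, dotProduct, Fintype.sum_sum_type, a, C, of_apply, Sum.elim_inl, Sum.elim_inr,
      mul_ite, mul_zero, Finset.sum_ite_eq', Finset.mem_univ, if_true, ite_mul, zero_mul,
      Pi.zero_apply]
    field_simp
    ring
  have hap : a ⬝ᵥ p = l := by
    simp only [dotProduct, Fintype.sum_sum_type, a, p, Sum.elim_inl, Sum.elim_inr,
      mul_ite, mul_zero, Finset.sum_ite_eq', Finset.mem_univ, if_true, ite_mul, zero_mul,
      Finset.sum_const_zero, zero_add]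
    field_simp
  have haa : a ⬝ᵥ a = l ^ 2 / σ ^ 2 * ∑ i, G (j, i) ^ 2 + l ^ 2 / t ^ 2 := by
    simp only [dotProduct, Fintype.sum_sum_type, a, Sum.elim_inl, Sum.elim_inr,
      mul_ite, mul_zero, Finset.sum_ite_eq', Finset.mem_univ, if_true, ite_mul, zero_mul]
    rw [Finset.mul_sum]
    congr 1
    · exact Finset.sum_congr rfl fun i _ => by ring
    · ring
  have h1 := le_lintegral_sq_sub_gaussianVec v hf p ha
  have h2 := (measurePreserving_sumPiEquivProdPi_symm
    (fun _ : (Fin q × Fin m) ⊕ Fin d => gaussianReal 0 v))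
  have hp : Measurable fun x : (Fin q × Fin m) ⊕ Fin d → ℝ => x ⬝ᵥ p := by
    unfold dotProduct; fun_prop
  have hu : Measurable fun x => ENNReal.ofReal ((f (x ᵥ* C) - x ⬝ᵥ p) ^ 2) :=
    (((hf.comp (measurable_vecMul_const C)).sub hp).pow_const 2).ennreal_ofReal
  have h3 := h2.lintegral_comp hu
  have hu' := hu.comp h2.measurable
  simp only [Function.comp_def] at hu'
  rw [lintegral_prod _ hu'.aemeasurable] at h3
  rw [← h3] at h1
  have e1 : ∀ (ξ : Fin q × Fin m → ℝ) (η : Fin d → ℝ),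
      (MeasurableEquiv.sumPiEquivProdPi fun _ : (Fin q × Fin m) ⊕ Fin d => ℝ).symm (ξ, η) ᵥ* C
        = fun i => σ * ξ i + ∑ k, G (k, i) * (t * η k) := fun ξ η => by
    ext i
    simp only [vecMul, dotProduct, Fintype.sum_sum_type, C, of_apply, Sum.elim_inl, Sum.elim_inr,
      MeasurableEquiv.sumPiEquivProdPi, MeasurableEquiv.symm_mk, MeasurableEquiv.coe_mk,
      Equiv.sumPiEquivProdPi_symm_apply,
      mul_ite, mul_zero, Finset.sum_ite_eq', Finset.mem_univ, if_true]
    rw [mul_comm]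
    congr 1
    exact Finset.sum_congr rfl fun k _ => by ring
  have e2 : ∀ (ξ : Fin q × Fin m → ℝ) (η : Fin d → ℝ),
      (MeasurableEquiv.sumPiEquivProdPi fun _ : (Fin q × Fin m) ⊕ Fin d => ℝ).symm (ξ, η) ⬝ᵥ p
        = t * η j := fun ξ η => by
    simp only [dotProduct, Fintype.sum_sum_type, p, Sum.elim_inl, Sum.elim_inr,
      MeasurableEquiv.sumPiEquivProdPi, MeasurableEquiv.symm_mk, MeasurableEquiv.coe_mk,
      Equiv.sumPiEquivProdPi_symm_apply,
      mul_ite, mul_zero, Finset.sum_ite_eq', Finset.mem_univ, if_true, Finset.sum_const_zero,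
      zero_add]
    rw [mul_comm]
  simp only [e1, e2] at h1
  rw [← ENNReal.ofReal_sum_of_nonneg fun i _ => sq_nonneg _, ← ENNReal.ofReal_mul (by positivity)]
  have h5 : (v * (2 * l - l ^ 2 / t ^ 2) : ℝ) = v * (2 * (a ⬝ᵥ p) - a ⬝ᵥ a)
      + v * (l ^ 2 / σ ^ 2) * ∑ i, G (j, i) ^ 2 := by
    rw [hap, haa]; ring
  rw [h5]
  exact ENNReal.ofReal_add_le.trans (add_le_add h1 le_rfl)

/-! ### The worst-case lower bound -/

/-- If the estimator `h (G, y)` of `θ` from `y = σ ξ + G θ` has at most the error `K` for all `θ`,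
then its Bayes risk for the prior `N(0, t² / m)` on the coordinates of `θ` is at most `K`, and so is
any lower bound for that risk. -/
lemma bayes_risk_le {q m d : ℕ} (hq : 0 < q) (hm : 0 < m) {σ t : ℝ} (hσ : σ ≠ 0) (ht : t ≠ 0)
    {h : (Fin d × (Fin q × Fin m) → ℝ) × (Fin q × Fin m → ℝ) → Fin d → ℝ} (hh : Measurable h)
    {u : (Fin d → ℝ) → (Fin d × (Fin q × Fin m) → ℝ) × (Fin q × Fin m → ℝ) → Fin d → ℝ}
    (hu : ∀ θ p, u θ p = h (p.1, fun i => σ * p.2 i + ∑ k, p.1 (k, i) * θ k) - θ) {K : ℝ≥0∞}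
    (hK : ∀ θ, ∫⁻ p, ENNReal.ofReal (u θ p ⬝ᵥ u θ p)
      ∂((gaussianVec (Fin d × (Fin q × Fin m)) (m : ℝ≥0)⁻¹).prod
        (gaussianVec (Fin q × Fin m) (m : ℝ≥0)⁻¹)) ≤ K) :
    ENNReal.ofReal (d * ((m : ℝ)⁻¹ * (σ ^ 2 / q) - (m : ℝ)⁻¹ * (σ ^ 2 / q) ^ 2 / t ^ 2)) ≤ K := by
  have hm' : (m : ℝ) ≠ 0 := by exact_mod_cast hm.ne'
  have hq' : (q : ℝ) ≠ 0 := by exact_mod_cast hq.ne'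
  have hvr : (((m : ℝ≥0)⁻¹ : ℝ≥0) : ℝ) = (m : ℝ)⁻¹ := by rw [NNReal.coe_inv, NNReal.coe_natCast]
  generalize (m : ℝ≥0)⁻¹ = v at hvr hK
  have hum : Measurable fun r : ((Fin d × (Fin q × Fin m) → ℝ) × (Fin q × Fin m → ℝ)) ×
      (Fin d → ℝ) => u (t • r.2) r.1 := by
    simp only [hu]
    have hy : Measurable fun r : ((Fin d × (Fin q × Fin m) → ℝ) × (Fin q × Fin m → ℝ)) ×
        (Fin d → ℝ) => fun i => σ * r.1.2 i + ∑ k, r.1.1 (k, i) * (t • r.2) k := by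
      simp only [Pi.smul_apply]
      fun_prop
    have hθ : Measurable fun r : ((Fin d × (Fin q × Fin m) → ℝ) × (Fin q × Fin m → ℝ)) ×
        (Fin d → ℝ) => t • r.2 := by fun_prop
    exact (hh.comp (measurable_fst.fst.prodMk hy)).sub hθ
  have hd : Measurable fun w : Fin d → ℝ => ENNReal.ofReal (w ⬝ᵥ w) := by
    unfold dotProduct; fun_prop
  have h2 : ∫⁻ p, ∫⁻ η, ENNReal.ofReal (u (t • η) p ⬝ᵥ u (t • η) p) ∂(gaussianVec (Fin d) v)
      ∂((gaussianVec (Fin d × (Fin q × Fin m)) v).prod (gaussianVec (Fin q × Fin m) v)) ≤ K := by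
    have hsw := lintegral_lintegral_swap (μ := (gaussianVec (Fin d × (Fin q × Fin m)) v).prod
      (gaussianVec (Fin q × Fin m) v)) (ν := gaussianVec (Fin d) v)
      (f := fun p η => ENNReal.ofReal (u (t • η) p ⬝ᵥ u (t • η) p)) (hd.comp hum).aemeasurable
    rw [hsw]
    refine (lintegral_mono fun η => hK (t • η)).trans ?_
    rw [lintegral_const, measure_univ, mul_one]
  refine le_trans ?_ h2
  have hjm : ∀ j, Measurable fun p => ∫⁻ η, ENNReal.ofReal (u (t • η) p j ^ 2)
      ∂(gaussianVec (Fin d) v) := fun j => by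
    have h1 : Measurable fun r : ((Fin d × (Fin q × Fin m) → ℝ) × (Fin q × Fin m → ℝ)) ×
        (Fin d → ℝ) => ENNReal.ofReal (u (t • r.2) r.1 j ^ 2) :=
      (((measurable_pi_apply j).comp hum).pow_const 2).ennreal_ofReal
    exact h1.lintegral_prod_right'
  have h3 : ∀ p, ∫⁻ η, ENNReal.ofReal (u (t • η) p ⬝ᵥ u (t • η) p) ∂(gaussianVec (Fin d) v)
      = ∑ j, ∫⁻ η, ENNReal.ofReal (u (t • η) p j ^ 2) ∂(gaussianVec (Fin d) v) := fun p =>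
    lintegral_ofReal_dotProduct_self (f := fun η => u (t • η) p)
      (hum.comp measurable_prodMk_left)
  rw [lintegral_congr h3, lintegral_finsetSum _ fun j _ => hjm j,
    ENNReal.ofReal_mul (Nat.cast_nonneg d), ENNReal.ofReal_natCast]
  -- the multiple of the score that is optimal in the limit `t → ∞`
  set l : ℝ := σ ^ 2 / q with hl
  have hsum : (d : ℝ≥0∞) * ENNReal.ofReal ((m : ℝ)⁻¹ * l - (m : ℝ)⁻¹ * l ^ 2 / t ^ 2)
      = ∑ _j : Fin d, ENNReal.ofReal ((m : ℝ)⁻¹ * l - (m : ℝ)⁻¹ * l ^ 2 / t ^ 2) := by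
    rw [Finset.sum_const, Finset.card_univ, Fintype.card_fin, nsmul_eq_mul]
  rw [hsum]
  refine Finset.sum_le_sum fun j _ => ?_
  rw [lintegral_prod _ (hjm j).aemeasurable]
  have h4 : ∀ G : Fin d × (Fin q × Fin m) → ℝ, ENNReal.ofReal (v * (2 * l - l ^ 2 / t ^ 2)) ≤
      (∫⁻ ξ, ∫⁻ η, ENNReal.ofReal (u (t • η) (G, ξ) j ^ 2) ∂(gaussianVec (Fin d) v)
        ∂(gaussianVec (Fin q × Fin m) v))
      + ENNReal.ofReal (v * (l ^ 2 / σ ^ 2)) * ∑ i, ENNReal.ofReal (G (j, i) ^ 2) := fun G => by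
    have := le_lintegral_bayes_error v hσ ht l G (f := fun y => h (G, y) j)
      ((measurable_pi_apply j).comp (hh.comp measurable_prodMk_left)) j
    simpa only [hu, Pi.sub_apply, Pi.smul_apply, smul_eq_mul] using this
  have h5 := lintegral_mono (μ := gaussianVec (Fin d × (Fin q × Fin m)) v) h4
  rw [lintegral_const, measure_univ, mul_one, lintegral_add_left (hjm j).lintegral_prod_right',
    lintegral_const_mul' _ _ ENNReal.ofReal_ne_top, lintegral_finsetSum _ fun i _ => by fun_prop]
    at h5
  -- the sketches carry the information `E ∑ᵢ G(j, i)² = q m v = q` about `θⱼ`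
  have h6 : ∀ i : Fin q × Fin m, ∫⁻ G, ENNReal.ofReal (G (j, i) ^ 2)
      ∂(gaussianVec (Fin d × (Fin q × Fin m)) v) = ENNReal.ofReal v := fun i => by
    have := lintegral_sq_dotProduct_gaussianVec v (Pi.single (j, i) (1 : ℝ))
    simpa using this
  rw [Finset.sum_congr rfl fun i _ => h6 i, Finset.sum_const, Finset.card_univ, Fintype.card_prod,
    Fintype.card_fin, Fintype.card_fin, nsmul_eq_mul, ← ENNReal.ofReal_natCast (q * m),
    ← ENNReal.ofReal_mul (Nat.cast_nonneg _), ← ENNReal.ofReal_mul (by positivity), hvr] at h5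
  have h7 : (m : ℝ)⁻¹ * (l ^ 2 / σ ^ 2) * (((q * m : ℕ) : ℝ) * (m : ℝ)⁻¹) = (m : ℝ)⁻¹ * l := by
    rw [hl]
    push_cast
    field_simp
  rw [h7, ← tsub_le_iff_right, ← ENNReal.ofReal_sub _ (by positivity)] at h5
  refine le_trans (le_of_eq ?_) h5
  congr 1
  ring

section

variable {Ω : Type*} [MeasurableSpace Ω] {P : Measure Ω} [IsProbabilityMeasure P] {q m n d : ℕ}
  {S : Fin q → Ω → Matrix (Fin m) (Fin n) ℝ}

lemma IsGaussianSketch.bayes_risk_le_iSup_expectedError (hS : IsGaussianSketch P S) (hq : 0 < q)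
    (hm : 0 < m) {g : Fin q → Estimator m d} (hgm : ∀ k, (g k).IsMeasurable)
    {A : Matrix (Fin n) (Fin d) ℝ} {b : Fin n → ℝ} {x : Fin d → ℝ} (hA : A.rank = d)
    (hx : IsLeastSquaresSol A b x) {σ : ℝ} (hσ0 : σ ≠ 0) (hσ : σ ^ 2 = lsCost A b x)
    {t : ℝ} (ht : t ≠ 0) :
    ENNReal.ofReal (d * ((m : ℝ)⁻¹ * (σ ^ 2 / q) - (m : ℝ)⁻¹ * (σ ^ 2 / q) ^ 2 / t ^ 2))
      ≤ ⨆ z : Fin d → ℝ, expectedError P S g A (b + A *ᵥ z) (x + z) := by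
  obtain ⟨R, hRu, hR⟩ := exists_transpose_mul_self_of_posDef (posDef_transpose_mul_self_of_rank hA)
  have hRR : ∀ y, R *ᵥ (R⁻¹ *ᵥ y) = y := fun y => by
    rw [mulVec_mulVec, mul_nonsing_inv _ ((isUnit_iff_isUnit_det _).1 hRu), one_mulVec]
  -- the error `R (x̄ - x)` of the estimate from the data `(Gₖ R, Gₖ R x + yₖ)`
  have hhm : Measurable fun p : (Fin d × (Fin q × Fin m) → ℝ) × (Fin q × Fin m → ℝ) =>
      R *ᵥ (arrayEstimate g (joinArray p ᵥ* blockDiagonal fun _ => augmentRoot R x 1) - x) :=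
    (measurable_mulVec_const R).comp ((((measurable_arrayEstimate hgm).comp
      (measurable_vecMul_const _)).comp (measurePreserving_joinArray _ _ 0).measurable).sub_const x)
  refine bayes_risk_le hq hm hσ0 ht hhm (fun _ _ => rfl) fun θ => ?_
  -- the parameter `θ` belongs to the target `b + A z` with `R z = θ`
  refine le_trans (le_of_eq ?_) (le_iSup _ (R⁻¹ *ᵥ θ))
  rw [hS.expectedError_eq hgm (isLeastSquaresSol_add hx _) hR
      (hσ.trans (lsCost_add_add A b x _).symm),
    ← (measurePreserving_joinArray (Fin d) (Fin q × Fin m) _).lintegral_comp]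
  · refine lintegral_congr fun p => ?_
    have : R *ᵥ (arrayEstimate g (joinArray p ᵥ* blockDiagonal fun _ =>
        augmentRoot R (x + R⁻¹ *ᵥ θ) σ) - (x + R⁻¹ *ᵥ θ))
        = R *ᵥ (arrayEstimate g (joinArray (p.1, fun i => σ * p.2 i + ∑ k, p.1 (k, i) * θ k) ᵥ*
          blockDiagonal fun _ => augmentRoot R x 1) - x) - θ := by
      rw [← Prod.mk.eta (p := p), joinArray_vecMul_augmentRoot_add, hRR, ← sub_sub, mulVec_sub R _
        (R⁻¹ *ᵥ θ), hRR]
    rw [this]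
  · have hd : Measurable fun w : Fin d → ℝ => ENNReal.ofReal (w ⬝ᵥ w) := by
      unfold dotProduct; fun_prop
    exact hd.comp ((measurable_mulVec_const R).comp (((measurable_arrayEstimate hgm).comp
      (measurable_vecMul_const _)).sub_const _))

/-- The worst-case lower bound, the limit of the Bayes bounds as the prior becomes flat. -/
theorem IsGaussianSketch.le_iSup_expectedError (hS : IsGaussianSketch P S) (hq : 0 < q)
    (hm : 0 < m) {g : Fin q → Estimator m d} (hgm : ∀ k, (g k).IsMeasurable)
    {A : Matrix (Fin n) (Fin d) ℝ} {b : Fin n → ℝ} {x : Fin d → ℝ} (hA : A.rank = d)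
    (hx : IsLeastSquaresSol A b x) :
    ENNReal.ofReal (lsCost A b x / q * (d / m))
      ≤ ⨆ z : Fin d → ℝ, expectedError P S g A (b + A *ᵥ z) (x + z) := by
  rcases (lsCost_nonneg A b x).eq_or_lt with hc | hc
  · simp [← hc]
  have hσ : (√(lsCost A b x)) ^ 2 = lsCost A b x := Real.sq_sqrt hc.le
  have hσ0 : √(lsCost A b x) ≠ 0 := (Real.sqrt_pos.2 hc).ne'
  have h1 : Filter.Tendsto (fun t : ℝ => ENNReal.ofReal (d * ((m : ℝ)⁻¹ * (lsCost A b x / q)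
      - (m : ℝ)⁻¹ * (lsCost A b x / q) ^ 2 / t ^ 2))) Filter.atTop
      (nhds (ENNReal.ofReal (d * ((m : ℝ)⁻¹ * (lsCost A b x / q) - 0)))) :=
    ENNReal.tendsto_ofReal (tendsto_const_nhds.mul (tendsto_const_nhds.sub
      (tendsto_const_nhds.div_atTop (Filter.tendsto_pow_atTop two_ne_zero))))
  have h2 : lsCost A b x / q * (d / m) = d * ((m : ℝ)⁻¹ * (lsCost A b x / q) - 0) := by ring
  rw [h2]
  refine le_of_tendsto h1 ((Filter.eventually_gt_atTop 0).mono fun t ht => ?_)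
  have := hS.bayes_risk_le_iSup_expectedError hq hm hgm hA hx hσ0 hσ ht.ne'
  rwa [hσ] at this

end

/-! ### Lower bounds and optimality -/

theorem mainTheorem5 {Ω : Type*} [MeasurableSpace Ω] (P : Measure Ω) [IsProbabilityMeasure P]
    (q m n d : ℕ) (hq : 0 < q) (hm : 0 < m)
    (S : Fin q → Ω → Matrix (Fin m) (Fin n) ℝ) (hS : IsGaussianSketch P S) :
    -- (i) the lower bound for unbiased estimators
    (d + 1 < m →
      ∀ g : Fin q → Estimator m d, (∀ k, (g k).IsMeasurable) →
        (∀ k, IsUnbiased P (S k) (g k)) →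
        ∀ (A : Matrix (Fin n) (Fin d) ℝ) (b : Fin n → ℝ) (xs : Fin d → ℝ),
          A.rank = d → IsLeastSquaresSol A b xs →
          ENNReal.ofReal (lsCost A b xs / q * (d / ((m : ℝ) - d - 1)))
            ≤ expectedError P S g A b xs) ∧
    -- optimality: averaged sketched least squares is unbiased and attains the bound in (i)
    (d + 1 < m →
      ∀ g : Fin q → Estimator m d, (∀ k, (g k).IsMeasurable) →
        (∀ k, (g k).IsSketchedLeastSquares) →
        (∀ k, IsUnbiased P (S k) (g k)) ∧
        ∀ (A : Matrix (Fin n) (Fin d) ℝ) (b : Fin n → ℝ) (xs : Fin d → ℝ),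
          A.rank = d → IsLeastSquaresSol A b xs →
          expectedError P S g A b xs
            = ENNReal.ofReal (lsCost A b xs / q * (d / ((m : ℝ) - d - 1)))) ∧
    -- (ii) the worst-case lower bound for arbitrary estimators (which may depend on `A` and on
    -- the residual `b - A x*`), over all targets `b + A z` with the same residual as `b`; their
    -- least squares solutions are the `x* + z`
    (∀ (A : Matrix (Fin n) (Fin d) ℝ) (b : Fin n → ℝ) (xs : Fin d → ℝ),
      A.rank = d → IsLeastSquaresSol A b xs →
      ∀ g : Fin q → Estimator m d, (∀ k, (g k).IsMeasurable) →
        ENNReal.ofReal (lsCost A b xs / q * (d / m))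
          ≤ ⨆ z : Fin d → ℝ, expectedError P S g A (b + A *ᵥ z) (xs + z)) := by
  refine ⟨fun hdm g hgm hg A b xs hA hx => hS.le_expectedError_of_isUnbiased hq hdm hgm hg hA hx,
    fun hdm g hgm hg => ?_, fun A b xs hA hx g hgm => hS.le_iSup_expectedError hq hm hgm hA hx⟩
  have hls : ∀ k M y, (Mᵀ * M).det ≠ 0 → g k M y = leastSquaresEstimator m d M y :=
    fun k M y hM => (isLeastSquaresSol_iff_eq hM).1 (hg k M y)
  exact ⟨fun k => hS.isUnbiased hdm (hgm k) (hls k) k,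
    fun A b xs hA hx => hS.expectedError_leastSquares hq hdm hgm hls hA hx⟩
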